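/- A \emph{polyhedron} is a nonempty bounded set $P\subset\mathbb R^3$, not necessarily convex, that is a finite union of finite intersections of closed half-spaces and is the closure of its interior. Its (open) faces are the connected components of the set of boundary points near which $P$ is a half-space; the remaining boundary points form the skeleton, whose points near which $P$ is invariant under translation along a line form the (open) edges, the components of this set, and whose other points are the vertices. The degree $\deg(H)$ of a vertex $H$ is the number of edges ending at $H$. Let $e(P)$ be the total edge length and $v(P)$ the volume of $P$; the Melzak ratio is $m(P)=e(P)^3/v(P)$. A vertex $H$ of $P$ is \emph{exposed} if it has an open neighborhood $U$ such that $U\cap P$ is convex. In this case the Gauss image $g(H)\subset S^2$ is the convex spherical polygon whose vertices are the outward unit normals of the faces at $H$ and whose sides are the geodesics joining the normals of faces adjacent along an edge at $H$. The inradius $\theta_H$ is the largest angular radius of a disc of $S^2$ contained in $g(H)$, and an incenter is the center $c_H\in S^2$ of such a largest disc. \textbf{Theorem.} Let $P$ be a polyhedron and let $H$ be an exposed vertex of $P$ with $$\deg(H)>\frac{2\pi}{\tan\theta_H}.$$ Then $g(H)$ has an incenter $c_H$ such that, for every open neighborhood $U$ of $H$ with $U\cap P$ convex and for all sufficiently small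 $t>0$, the set $$P_t=(P\setminus U)\cup\{x\in U\cap P:\ \langle c_H,x-H\rangle\le -t\},$$ obtained from $P$ by shaving off a small corner at $H$ by a plane normal to $c_H$, is a polyhedron with exactly one more face than $P$ and with $m(P_t)<m(P)$. -/

import Mathlib

open scoped Topology

noncomputable section

namespace Melzak

/-- Euclidean three-space. -/
abbrev E3 : Type := EuclideanSpace ℝ (Fin 3)

/-- A (solid, not necessarily convex) polyhedron: a nonempty bounded set which is a finite union of
finite intersections of closed half-spaces and is the closure of its interior. -/
structure IsPolyhedron (P : Set E3) : Prop where
  nonempty : P.Nonempty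
  bounded : Bornology.IsBounded P
  regular : closure (interior P) = P
  polyhedral : ∃ S : Finset (Finset (E3 × ℝ)),
    P = ⋃ s ∈ S, ⋂ h ∈ s, {x : E3 | inner ℝ h.1 x ≤ h.2}

/-- `n` is the outward unit normal of `P` at `x`: near `x`, the set `P` is the half-space through
`x` with outward unit normal `n`. -/
def IsOutwardNormalAt (P : Set E3) (n x : E3) : Prop :=
  ‖n‖ = 1 ∧ ∃ r > 0, ∀ y ∈ Metric.ball x r, y ∈ P ↔ inner ℝ n (y - x) ≤ 0

/-- The points in the relative interiors of the faces: the boundary points at which `P` is locally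
a half-space. -/
def facePoints (P : Set E3) : Set E3 := {x | ∃ n, IsOutwardNormalAt P n x}

/-- The union of all edges and vertices: the boundary points at which `P` is not locally a
half-space. -/
def skeleton (P : Set E3) : Set E3 := frontier P \ facePoints P

/-- Near `x`, the set `P` is invariant under translations along `d`. -/
def IsLocallyInvariant (P : Set E3) (x d : E3) : Prop :=
  ∃ r > 0, ∀ y ∈ Metric.ball x r, ∀ s : ℝ, y + s • d ∈ Metric.ball x r →
    (y ∈ P ↔ y + s • d ∈ P)

/-- The points in the relative interiors of the edges: the points of the skeleton near which `P` is
invariant along a line (the line of the edge). -/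
def edgePoints (P : Set E3) : Set E3 :=
  {x | x ∈ skeleton P ∧ ∃ d : E3, d ≠ 0 ∧ IsLocallyInvariant P x d}

/-- The vertices: the remaining points of the skeleton. -/
def vertices (P : Set E3) : Set E3 := skeleton P \ edgePoints P

/-- The (relatively open) faces. -/
def faces (P : Set E3) : Set (Set E3) :=
  {F | ∃ x ∈ facePoints P, F = connectedComponentIn (facePoints P) x}

/-- The (relatively open) edges. -/
def edges (P : Set E3) : Set (Set E3) :=
  {e | ∃ x ∈ edgePoints P, e = connectedComponentIn (edgePoints P) x}

/-- The degree of a vertex: the number of edges ending at it. -/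
def degree (P : Set E3) (H : E3) : ℕ := {e | e ∈ edges P ∧ H ∈ closure e}.ncard

/-- The number of faces. -/
def numFaces (P : Set E3) : ℕ∞ := (faces P).encard

/-- The total edge length `e(P)`: the one-dimensional Hausdorff measure of the skeleton. -/
def edgeLength (P : Set E3) : ℝ := (MeasureTheory.Measure.hausdorffMeasure 1 (skeleton P)).toReal

/-- The volume `v(P)`. -/
def vol (P : Set E3) : ℝ := (MeasureTheory.volume P).toReal

/-- The Melzak ratio `m(P) = e(P)³ / v(P)`. -/
def melzakRatio (P : Set E3) : ℝ := edgeLength P ^ 3 / vol P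

/-- `H` is an exposed vertex: a vertex with an open neighbourhood `U` such that `U ∩ P` is convex. -/
def IsExposedVertex (P : Set E3) (H : E3) : Prop :=
  H ∈ vertices P ∧ ∃ U : Set E3, IsOpen U ∧ H ∈ U ∧ Convex ℝ (U ∩ P)

/-- `n` is the outward unit normal of the face `F`. -/
def IsFaceNormal (P F : Set E3) (n : E3) : Prop :=
  F ∈ faces P ∧ ∀ x ∈ F, IsOutwardNormalAt P n x

/-- The images under the Gauss map of the faces at `H`. -/
def gaussVertices (P : Set E3) (H : E3) : Set E3 :=
  {n | ∃ F, IsFaceNormal P F n ∧ H ∈ closure F}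

/-- The minimal geodesic of the unit sphere between two (non-antipodal) unit vectors. -/
def geodesic (n n' : E3) : Set E3 :=
  {y | ‖y‖ = 1 ∧ ∃ a b : ℝ, 0 ≤ a ∧ 0 ≤ b ∧ y = a • n + b • n'}

/-- The geodesics joining the Gauss images of faces that are adjacent along an edge at `H`. -/
def gaussEdges (P : Set E3) (H : E3) : Set E3 :=
  {y | ∃ F F' e n n', IsFaceNormal P F n ∧ IsFaceNormal P F' n' ∧ F ≠ F' ∧
    e ∈ edges P ∧ H ∈ closure e ∧ e ⊆ closure F ∧ e ⊆ closure F' ∧ y ∈ geodesic n n'}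

/-- The spherical convex hull of a subset of the unit sphere (contained in an open hemisphere): the
radial projection of its convex hull. -/
def sphericalHull (S : Set E3) : Set E3 :=
  {y | ‖y‖ = 1 ∧ ∃ a : ℝ, 0 < a ∧ ∃ z ∈ convexHull ℝ S, y = a • z}

/-- The Gauss image `g(H)` at an exposed vertex `H`, as a convex region of the sphere: the convex
spherical polygon whose vertices and sides are the normals of the faces at `H` and the geodesics
between normals of adjacent faces. -/
def gaussImage (P : Set E3) (H : E3) : Set E3 :=
  sphericalHull (gaussVertices P H ∪ gaussEdges P H)

/-- The closed disc of the unit sphere with centre `c` and angular radius `ρ`. -/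
def sphericalDisc (c : E3) (ρ : ℝ) : Set E3 :=
  {y | ‖y‖ = 1 ∧ InnerProductGeometry.angle c y ≤ ρ}

/-- The inradius of a region of the sphere: the largest angular radius of an inscribed disc. -/
def inradius (g : Set E3) : ℝ :=
  sSup {ρ : ℝ | 0 ≤ ρ ∧ ∃ c : E3, ‖c‖ = 1 ∧ sphericalDisc c ρ ⊆ g}

/-- `c` is an incenter of the region `g`: the centre of an inscribed disc of largest radius. -/
def IsIncenter (g : Set E3) (c : E3) : Prop :=
  ‖c‖ = 1 ∧ sphericalDisc c (inradius g) ⊆ g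

/-- Shaving off the corner `H`: inside `U`, the set `P` is intersected with the half-space with
outward normal `c` whose boundary plane is at distance `t` inward from `H`. -/
def shave (P U : Set E3) (H c : E3) (t : ℝ) : Set E3 :=
  (P \ U) ∪ (U ∩ P ∩ {x | inner ℝ c (x - H) ≤ -t})

end Melzak

end

/-!
Near an exposed vertex `H` the polyhedron `P` is a convex cone, polar to the finite set `N` of the
normals of the faces at `H` (`IsExposedVertex.exists_isCorner`). A point outside the cone is
separated from it by one of these normals: a segment joining it to a generic point of the cone
avoids the lines where two transversal bounding planes meet, so it leaves the cone at a face point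
(`exists_mem_gaussVertices_inner_pos`). Since `H` is not on an edge, `N` spans the space, and the
Gauss image, the part of the unit sphere in the convex cone over `N`, contains a disc. It is compact
and lies in an open hemisphere, so it has an incenter `c`, and its inradius `θ` satisfies
`0 < θ < π / 2` (`exists_isIncenter`).

The Gauss image lies in the polar of the cone of `P` at `H`. Testing the vectors `v` of this cone
against the disc of radius `θ` about `c` shows that the part of `v` orthogonal to `c` has length at
most `-⟪c, v⟫ / tan θ` (`norm_orthComp_mul_sin_le`). Hence the plane at depth `t` below `H` cuts off
a cap of size of order `t`, whose base lies in a disc of radius `t / tan θ`.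

* Each of the `deg H` edges at `H` loses a length of at least `t` (`CornerCut.degree_mul_le`), while
  the new edges form the boundary of a convex region inside this disc, of length at most
  `2 * π * t / tan θ` (`CornerCut.hausdorffMeasure_capRing_le`). By hypothesis the total edge length
  drops by at least a positive multiple of `t` (`CornerCut.edgeLength_diff_le`), whereas the volume
  drops by at most a multiple of `t ^ 3` (`CornerCut.le_vol_diff`). So the Melzak ratio decreases
  for small `t`.
* The base of the cap is a new face, and a continuous map radial about `H` carries every old face
  onto what remains of it, which is therefore connected and nonempty (`CornerCut.image_push`). This
  gives exactly one additional face (`CornerCut.numFaces_diff`).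
-/

namespace Melzak

/-! ### Germs of sets up to homothety -/

/-- Near `z`, the set `Q` looks like the image of `P` near `x` under the homothety of ratio `k`
taking `x` to `z`. -/
def SameGerm (k : ℝ) (P : Set E3) (x : E3) (Q : Set E3) (z : E3) : Prop :=
  0 < k ∧ ∀ᶠ v in 𝓝 (0 : E3), (x + v ∈ P ↔ z + k • v ∈ Q)

theorem tendsto_smul_nhds_zero (k : ℝ) :
    Filter.Tendsto (fun v : E3 => k • v) (𝓝 0) (𝓝 0) := by
  have h : Continuous (fun v : E3 => k • v) := by fun_prop
  simpa using h.tendsto 0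

theorem SameGerm.symm {k : ℝ} {P Q : Set E3} {x z : E3} (h : SameGerm k P x Q z) :
    SameGerm k⁻¹ Q z P x := by
  refine ⟨inv_pos.2 h.1, ?_⟩
  filter_upwards [(tendsto_smul_nhds_zero k⁻¹).eventually h.2] with v hv
  rw [hv, smul_inv_smul₀ h.1.ne']

theorem sameGerm_one_of_eventually {P Q : Set E3} {x : E3}
    (h : ∀ᶠ y in 𝓝 x, (y ∈ P ↔ y ∈ Q)) : SameGerm 1 P x Q x := by
  refine ⟨one_pos, ?_⟩
  have h1 : Filter.Tendsto (fun v : E3 => x + v) (𝓝 0) (𝓝 x) := by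
    have : Continuous (fun v : E3 => x + v) := by fun_prop
    simpa using this.tendsto 0
  filter_upwards [h1.eventually h] with v hv
  simpa using hv

theorem eventually_nhds_iff_add {p : E3 → Prop} {x : E3} :
    (∀ᶠ y in 𝓝 x, p y) ↔ ∀ᶠ v in 𝓝 (0 : E3), p (x + v) := by
  rw [← map_add_left_nhds_zero x, Filter.eventually_map]

theorem isOutwardNormalAt_iff {P : Set E3} {n x : E3} :
    IsOutwardNormalAt P n x ↔
      ‖n‖ = 1 ∧ ∀ᶠ v in 𝓝 (0 : E3), (x + v ∈ P ↔ inner ℝ n v ≤ 0) := by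
  refine and_congr_right fun _ => ?_
  have h : (∃ r > 0, ∀ y ∈ Metric.ball x r, y ∈ P ↔ inner ℝ n (y - x) ≤ 0) ↔
      ∀ᶠ y in 𝓝 x, (y ∈ P ↔ inner ℝ n (y - x) ≤ 0) := by
    rw [Metric.eventually_nhds_iff_ball]
  rw [h, eventually_nhds_iff_add]
  simp

theorem SameGerm.isOutwardNormalAt {k : ℝ} {P Q : Set E3} {x z n : E3}
    (h : SameGerm k P x Q z) (hn : IsOutwardNormalAt P n x) : IsOutwardNormalAt Q n z := by
  rw [isOutwardNormalAt_iff] at hn ⊢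
  refine ⟨hn.1, ?_⟩
  have hk := h.symm
  filter_upwards [(tendsto_smul_nhds_zero k⁻¹).eventually hn.2, hk.2] with v hv hv'
  rw [hv', hv, inner_smul_right]
  constructor
  · intro h1; exact nonpos_of_mul_nonpos_right h1 hk.1
  · intro h1; exact mul_nonpos_of_nonneg_of_nonpos hk.1.le h1

theorem SameGerm.mem_facePoints {k : ℝ} {P Q : Set E3} {x z : E3}
    (h : SameGerm k P x Q z) (hx : x ∈ facePoints P) : z ∈ facePoints Q :=
  let ⟨n, hn⟩ := hx
  ⟨n, h.isOutwardNormalAt hn⟩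

theorem mem_frontier_iff_frequently {P : Set E3} {x : E3} :
    x ∈ frontier P ↔ (∃ᶠ v in 𝓝 (0 : E3), x + v ∈ P) ∧ ∃ᶠ v in 𝓝 (0 : E3), x + v ∉ P := by
  rw [frontier_eq_closure_inter_closure, Set.mem_inter_iff, mem_closure_iff_frequently,
    mem_closure_iff_frequently, ← map_add_left_nhds_zero x, Filter.frequently_map,
    Filter.frequently_map]
  rfl

theorem SameGerm.mem_frontier {k : ℝ} {P Q : Set E3} {x z : E3}
    (h : SameGerm k P x Q z) (hx : x ∈ frontier P) : z ∈ frontier Q := by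
  rw [mem_frontier_iff_frequently] at hx ⊢
  constructor
  · refine (tendsto_smul_nhds_zero k).frequently ?_
    exact (hx.1.and_eventually h.2).mono fun v hv => hv.2.1 hv.1
  · refine (tendsto_smul_nhds_zero k).frequently ?_
    exact (hx.2.and_eventually h.2).mono fun v hv h' => hv.1 (hv.2.2 h')

theorem SameGerm.isLocallyInvariant {k : ℝ} {P Q : Set E3} {x z d : E3}
    (h : SameGerm k P x Q z) (hx : IsLocallyInvariant P x d) : IsLocallyInvariant Q z d := by
  obtain ⟨r, hr, H⟩ := hx
  obtain ⟨r', hr', H'⟩ := Metric.eventually_nhds_iff_ball.1 h.2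
  have hk := h.1
  refine ⟨k * min r r', by positivity, ?_⟩
  have key : ∀ y ∈ Metric.ball z (k * min r r'), x + k⁻¹ • (y - z) ∈ Metric.ball x r ∧
      (y ∈ Q ↔ x + k⁻¹ • (y - z) ∈ P) := by
    intro y hy
    have h1 : ‖k⁻¹ • (y - z)‖ < min r r' := by
      rw [norm_smul, norm_inv, Real.norm_of_nonneg hk.le, inv_mul_lt_iff₀ hk]
      simpa [dist_eq_norm] using hy
    refine ⟨?_, ?_⟩
    · simpa [dist_eq_norm] using h1.trans_le (min_le_left _ _)
    · have := H' (k⁻¹ • (y - z)) (by simpa using h1.trans_le (min_le_right _ _))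
      rw [this, smul_inv_smul₀ hk.ne']
      simp
  intro y hy s hys
  have e : x + k⁻¹ • (y + s • d - z) = x + k⁻¹ • (y - z) + (k⁻¹ * s) • d := by
    rw [mul_smul]; simp only [smul_sub, smul_add]; abel
  obtain ⟨a1, a2⟩ := key y hy
  obtain ⟨b1, b2⟩ := key _ hys
  rw [a2, b2, e]
  rw [e] at b1
  exact H _ a1 _ b1

theorem SameGerm.mem_skeleton {k : ℝ} {P Q : Set E3} {x z : E3}
    (h : SameGerm k P x Q z) (hx : x ∈ skeleton P) : z ∈ skeleton Q :=
  ⟨h.mem_frontier hx.1, fun hz => hx.2 (h.symm.mem_facePoints hz)⟩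

theorem SameGerm.mem_edgePoints {k : ℝ} {P Q : Set E3} {x z : E3}
    (h : SameGerm k P x Q z) (hx : x ∈ edgePoints P) : z ∈ edgePoints Q :=
  let ⟨d, hd, hd'⟩ := hx.2
  ⟨h.mem_skeleton hx.1, d, hd, h.isLocallyInvariant hd'⟩

/-! ### Outward normals -/

/-- Every vector on which `n` is nonpositive lies in the half-space of `m`, hence `m` is a
nonnegative multiple of `n`; for unit vectors they agree. -/
theorem eq_of_halfSpace_subset {n m : E3} (hn : ‖n‖ = 1) (hm : ‖m‖ = 1)
    (h : ∀ v : E3, inner ℝ n v ≤ 0 → inner ℝ m v ≤ 0) : n = m := by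
  have hnn : inner ℝ n n = (1 : ℝ) := by rw [real_inner_self_eq_norm_sq, hn]; norm_num
  have hmm : inner ℝ m m = (1 : ℝ) := by rw [real_inner_self_eq_norm_sq, hm]; norm_num
  have h1 := h (m - (inner ℝ n m) • n) (by
    rw [inner_sub_right, inner_smul_right, hnn]; simp)
  have h2 := h (-n) (by rw [inner_neg_right, hnn]; norm_num)
  rw [inner_sub_right, inner_smul_right, hmm, real_inner_comm n m] at h1
  rw [inner_neg_right, real_inner_comm n m] at h2
  have h3 : inner ℝ n m ≤ ‖n‖ * ‖m‖ := real_inner_le_norm n m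
  rw [hn, hm] at h3
  exact (inner_eq_one_iff_of_norm_eq_one (𝕜 := ℝ) hn hm).1
    (le_antisymm (by linarith) (by nlinarith))

/-- A statement about `v` that holds near `0` and only depends on the ray of `v` holds
everywhere. -/
theorem forall_of_eventually_smul {p : E3 → Prop} (h : ∀ᶠ v in 𝓝 (0 : E3), p v)
    (hp : ∀ v : E3, ∀ s : ℝ, 0 < s → p (s • v) → p v) (v : E3) : p v := by
  have h1 : Filter.Tendsto (fun s : ℝ => s • v) (𝓝[>] 0) (𝓝 0) := by
    have : Continuous (fun s : ℝ => s • v) := by fun_prop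
    simpa using (this.tendsto 0).mono_left nhdsWithin_le_nhds
  obtain ⟨s, hs, hs'⟩ := ((h1.eventually h).and self_mem_nhdsWithin).exists
  exact hp v s hs' hs

theorem inner_nonpos_of_smul {n v : E3} {s : ℝ} (hs : 0 < s)
    (h : inner ℝ n (s • v) ≤ 0) : inner ℝ n v ≤ 0 := by
  rw [inner_smul_right] at h
  exact nonpos_of_mul_nonpos_right h hs

/-- If `P` lies, near a face point, in a half-space with that point on its boundary, then the two
half-spaces agree. -/
theorem IsOutwardNormalAt.eq_of_eventually {P : Set E3} {n m x : E3}
    (h : IsOutwardNormalAt P n x) (hm : ‖m‖ = 1)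
    (hP : ∀ᶠ v in 𝓝 (0 : E3), x + v ∈ P → inner ℝ m v ≤ 0) : n = m := by
  rw [isOutwardNormalAt_iff] at h
  refine eq_of_halfSpace_subset h.1 hm (forall_of_eventually_smul ?_ ?_)
  · filter_upwards [h.2, hP] with v h1 h2 h3 using h2 (h1.2 h3)
  · intro v s hs h1 h2
    refine inner_nonpos_of_smul hs (h1 ?_)
    rw [inner_smul_right]
    exact mul_nonpos_of_nonneg_of_nonpos hs.le h2

theorem IsOutwardNormalAt.unique {P : Set E3} {n m x : E3}
    (h : IsOutwardNormalAt P n x) (h' : IsOutwardNormalAt P m x) : n = m :=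
  h.eq_of_eventually h'.1 ((isOutwardNormalAt_iff.1 h').2.mono fun _ hv => hv.1)

theorem IsOutwardNormalAt.mem {P : Set E3} {n x : E3} (h : IsOutwardNormalAt P n x) : x ∈ P := by
  obtain ⟨_, r, hr, H⟩ := h
  exact (H x (Metric.mem_ball_self hr)).2 (by simp)

theorem facePoints_subset (P : Set E3) : facePoints P ⊆ P := fun _ ⟨_, h⟩ => h.mem

theorem facePoints_subset_frontier (P : Set E3) : facePoints P ⊆ frontier P := by
  rintro x ⟨n, h⟩
  refine ⟨subset_closure h.mem, fun hx => ?_⟩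
  rw [mem_interior_iff_mem_nhds] at hx
  obtain ⟨hn, h⟩ := isOutwardNormalAt_iff.1 h
  have h1 := eventually_nhds_iff_add.1 (show ∀ᶠ y in 𝓝 x, y ∈ P from hx)
  have h2 : inner ℝ n n ≤ 0 := by
    refine forall_of_eventually_smul (p := fun v => inner ℝ n v ≤ 0) ?_
      (fun v s hs hv => inner_nonpos_of_smul hs hv) n
    filter_upwards [h, h1] with v a b using a.1 b
  rw [real_inner_self_eq_norm_sq, hn] at h2
  norm_num at h2

/-- Near a face point, the face points lie in the boundary plane of the half-space and have the
same normal. -/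
theorem IsOutwardNormalAt.eventually {P : Set E3} {n x : E3} (h : IsOutwardNormalAt P n x) :
    ∀ᶠ y in 𝓝 x, y ∈ facePoints P → IsOutwardNormalAt P n y := by
  obtain ⟨hn, r, hr, H⟩ := h
  filter_upwards [Metric.ball_mem_nhds x hr] with y hy hyP
  have hball : ∀ᶠ z in 𝓝 y, z ∈ Metric.ball x r := Metric.isOpen_ball.mem_nhds hy
  have h0 : inner ℝ n (y - x) ≤ 0 := (H y hy).1 (facePoints_subset P hyP)
  have h1 : inner ℝ n (y - x) = 0 := by
    refine le_antisymm h0 (le_of_not_gt fun hlt => (facePoints_subset_frontier P hyP).2 ?_)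
    have hc : Continuous (fun z : E3 => (inner ℝ n (z - x) : ℝ)) := by fun_prop
    rw [mem_interior_iff_mem_nhds]
    filter_upwards [hball, hc.continuousAt.eventually_lt continuousAt_const hlt] with z hz hz'
    exact (H z hz).2 hz'.le
  rw [isOutwardNormalAt_iff]
  refine ⟨hn, ?_⟩
  filter_upwards [eventually_nhds_iff_add.1 hball] with v hv
  rw [H _ hv, show y + v - x = (y - x) + v by abel, inner_add_right, h1, zero_add]

/-- The outward normal is constant on connected sets of face points. -/
theorem IsOutwardNormalAt.of_isPreconnected {P s : Set E3} {n x y : E3}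
    (h : IsOutwardNormalAt P n x) (hs : IsPreconnected s) (hsP : s ⊆ facePoints P)
    (hx : x ∈ s) (hy : y ∈ s) : IsOutwardNormalAt P n y := by
  by_contra hcon
  -- the two open sets of points near which every face point has, or has not, the normal `n`
  let u : Set E3 := {z | ∀ᶠ y in 𝓝 z, y ∈ facePoints P → IsOutwardNormalAt P n y}
  let v : Set E3 := {z | ∀ᶠ y in 𝓝 z, y ∈ facePoints P → ¬ IsOutwardNormalAt P n y}
  have hu : IsOpen u := isOpen_setOfPred_eventually_nhds
  have hv : IsOpen v := isOpen_setOfPred_eventually_nhds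
  have hxu : x ∈ u := h.eventually
  have hcover : s ⊆ u ∪ v := by
    intro z hz
    obtain ⟨m, hm⟩ := hsP hz
    by_cases hmn : m = n
    · left; subst hmn; exact hm.eventually
    · right
      filter_upwards [hm.eventually] with a ha haP han
      exact hmn ((ha haP).unique han)
  have hyv : y ∈ v := (hcover hy).resolve_left fun hyu => hcon (hyu.self_of_nhds (hsP hy))
  obtain ⟨z, hz, hzu, hzv⟩ := hs u v hu hv hcover ⟨x, hx, hxu⟩ ⟨y, hy, hyv⟩
  exact hzv.self_of_nhds (hsP hz) (hzu.self_of_nhds (hsP hz))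

theorem IsOutwardNormalAt.isFaceNormal {P : Set E3} {n x : E3} (h : IsOutwardNormalAt P n x) :
    IsFaceNormal P (connectedComponentIn (facePoints P) x) n := by
  have hx : x ∈ facePoints P := ⟨n, h⟩
  exact ⟨⟨x, hx, rfl⟩, fun y hy => h.of_isPreconnected isPreconnected_connectedComponentIn
    (connectedComponentIn_subset _ _) (mem_connectedComponentIn hx) hy⟩

/-! ### Local structure of polyhedral sets -/

/-- The union over `s ∈ S` of the intersections of the closed half-spaces in `s`. -/
def polyUnion (S : Finset (Finset (E3 × ℝ))) : Set E3 :=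
  ⋃ s ∈ S, ⋂ h ∈ s, {x : E3 | inner ℝ h.1 x ≤ h.2}

/-- The half-spaces occurring in `S`. -/
def halfSpaces (S : Finset (Finset (E3 × ℝ))) : Set (E3 × ℝ) := {h | ∃ s ∈ S, h ∈ s}

theorem finite_halfSpaces (S : Finset (Finset (E3 × ℝ))) : (halfSpaces S).Finite := by
  have : halfSpaces S = ⋃ s ∈ S, (s : Set (E3 × ℝ)) := by ext; simp [halfSpaces]
  rw [this]
  exact S.finite_toSet.biUnion fun s _ => s.finite_toSet

theorem mem_polyUnion {S : Finset (Finset (E3 × ℝ))} {x : E3} :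
    x ∈ polyUnion S ↔ ∃ s ∈ S, ∀ h ∈ s, inner ℝ h.1 x ≤ h.2 := by
  simp [polyUnion]

theorem isClosed_polyUnion (S : Finset (Finset (E3 × ℝ))) : IsClosed (polyUnion S) := by
  refine S.finite_toSet.isClosed_biUnion fun s _ => isClosed_biInter fun h _ => ?_
  exact isClosed_le (by fun_prop) continuous_const

/-- Near `x`, membership in a polyhedral set depends only on the signs of the constraints that are
active at `x`, and no other constraint is active near `x`. -/
theorem exists_ball_polyUnion (S : Finset (Finset (E3 × ℝ))) (x : E3) :
    ∃ r > 0, (∀ h ∈ halfSpaces S, ∀ y ∈ Metric.ball x r, inner ℝ h.1 y = h.2 →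
        inner ℝ h.1 x = h.2) ∧
      ∀ y ∈ Metric.ball x r, ∀ z ∈ Metric.ball x r,
        (∀ h ∈ halfSpaces S, inner ℝ h.1 x = h.2 →
          (inner ℝ h.1 (y - x) ≤ 0 ↔ inner ℝ h.1 (z - x) ≤ 0)) →
        (y ∈ polyUnion S ↔ z ∈ polyUnion S) := by
  have key : ∀ᶠ y in 𝓝 x, ∀ h ∈ halfSpaces S, inner ℝ h.1 x ≠ h.2 →
      ((inner ℝ h.1 y ≤ h.2 ↔ inner ℝ h.1 x ≤ h.2) ∧ inner ℝ h.1 y ≠ h.2) := by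
    rw [Filter.eventually_all_finite (finite_halfSpaces S)]
    intro h _
    have hc : ContinuousAt (fun y : E3 => (inner ℝ h.1 y : ℝ)) x := by fun_prop
    rcases lt_trichotomy (inner ℝ h.1 x : ℝ) h.2 with hlt | heq | hgt
    · filter_upwards [hc.eventually_lt continuousAt_const hlt] with y hy _
      exact ⟨iff_of_true hy.le hlt.le, hy.ne⟩
    · exact Filter.Eventually.of_forall fun y hy => absurd heq hy
    · filter_upwards [continuousAt_const.eventually_lt hc hgt] with y hy _
      exact ⟨iff_of_false hy.not_ge hgt.not_ge, hy.ne'⟩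
  obtain ⟨r, hr, H⟩ := Metric.eventually_nhds_iff_ball.1 key
  refine ⟨r, hr, fun h hh y hy e => by_contra fun hne => (H y hy h hh hne).2 e, ?_⟩
  intro y hy z hz hyz
  rw [mem_polyUnion, mem_polyUnion]
  refine exists_congr fun s => and_congr_right fun hs => forall₂_congr fun h hh => ?_
  have hhS : h ∈ halfSpaces S := ⟨s, hs, hh⟩
  by_cases hact : inner ℝ h.1 x = h.2
  · have := hyz h hhS hact
    simpa [inner_sub_right, hact] using this
  · rw [(H y hy h hhS hact).1, (H z hz h hhS hact).1]

/-- Every polyhedral set is a cone near each point. -/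
theorem exists_ball_cone (S : Finset (Finset (E3 × ℝ))) (x : E3) :
    ∃ r > 0, (∀ h ∈ halfSpaces S, ∀ y ∈ Metric.ball x r, inner ℝ h.1 y = h.2 →
        inner ℝ h.1 x = h.2) ∧
      ∀ v : E3, ∀ k : ℝ, 0 < k → ‖v‖ < r → ‖k • v‖ < r →
        (x + v ∈ polyUnion S ↔ x + k • v ∈ polyUnion S) := by
  obtain ⟨r, hr, H1, H⟩ := exists_ball_polyUnion S x
  refine ⟨r, hr, H1, fun v k hk hv hkv => H _ (by simpa using hv) _ (by simpa using hkv) ?_⟩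
  intro h _ _
  rw [add_sub_cancel_left, add_sub_cancel_left, inner_smul_right]
  exact ⟨fun h' => mul_nonpos_of_nonneg_of_nonpos hk.le h',
    fun h' => nonpos_of_mul_nonpos_right h' hk⟩

/-- The unit vectors orthogonal to the bounding planes of the half-spaces in `S`. -/
def planeNormals (S : Finset (Finset (E3 × ℝ))) : Set E3 :=
  (fun h : E3 × ℝ => ‖h.1‖⁻¹ • h.1) '' halfSpaces S ∪
    (fun h : E3 × ℝ => -(‖h.1‖⁻¹ • h.1)) '' halfSpaces S

theorem finite_planeNormals (S : Finset (Finset (E3 × ℝ))) : (planeNormals S).Finite :=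
  ((finite_halfSpaces S).image _).union ((finite_halfSpaces S).image _)

theorem exists_mem_open_inner_sub_ne_zero {p : E3} (hp : p ≠ 0) {O : Set E3} (hO : IsOpen O)
    (hne : O.Nonempty) (x : E3) : ∃ y ∈ O, inner ℝ p (y - x) ≠ (0 : ℝ) := by
  obtain ⟨y, hy⟩ := hne
  by_contra! hcon
  have h1 : ∀ᶠ v in 𝓝 (0 : E3), y + v ∈ O := eventually_nhds_iff_add.1 (hO.mem_nhds hy)
  have h2 : inner ℝ p p = (0 : ℝ) := by
    refine forall_of_eventually_smul (p := fun v => inner ℝ p v = (0 : ℝ)) ?_ ?_ p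
    · filter_upwards [h1] with v hv
      have a := hcon y hy
      have b := hcon _ hv
      rw [show y + v - x = (y - x) + v by abel, inner_add_right, a, zero_add] at b
      exact b
    · intro v s hs h
      rw [inner_smul_right] at h
      exact (mul_eq_zero.1 h).resolve_left hs.ne'
  exact hp (inner_self_eq_zero.1 h2)

/-- Let `P` be a regular closed polyhedral set all of whose constraints active at the boundary point
`x` have normals parallel to the unit vector `p`. Then `P` is a half-space near `x`. -/
theorem isOutwardNormalAt_of_active_parallel {S : Finset (Finset (E3 × ℝ))}
    (hreg : closure (interior (polyUnion S)) = polyUnion S) {x p : E3}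
    (hx : x ∈ frontier (polyUnion S)) (hp : ‖p‖ = 1)
    (hact : ∀ h ∈ halfSpaces S, inner ℝ h.1 x = h.2 → ∃ c : ℝ, h.1 = c • p) :
    IsOutwardNormalAt (polyUnion S) p x ∨ IsOutwardNormalAt (polyUnion S) (-p) x := by
  obtain ⟨r, hr, _, H⟩ := exists_ball_polyUnion S x
  set P := polyUnion S with hP
  have hxP : x ∈ P := (isClosed_polyUnion S).frontier_subset hx
  -- points on the same side of the plane through `x` orthogonal to `p` are both in `P` or both not
  have side : ∀ y ∈ Metric.ball x r, ∀ z ∈ Metric.ball x r, ∀ k : ℝ, 0 < k →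
      inner ℝ p (z - x) = k * inner ℝ p (y - x) → (y ∈ P ↔ z ∈ P) := by
    intro y hy z hz k hk hyz
    refine H y hy z hz fun h hh hhx => ?_
    obtain ⟨c, hc⟩ := hact h hh hhx
    rw [hc, inner_smul_left, inner_smul_left, hyz]
    simp only [conj_trivial]
    rw [show c * (k * inner ℝ p (y - x)) = k * (c * inner ℝ p (y - x)) by ring]
    exact ⟨fun h' => mul_nonpos_of_nonneg_of_nonpos hk.le h',
      fun h' => nonpos_of_mul_nonpos_right h' hk⟩
  have key : ∀ q : E3, (q = p ∨ q = -p) →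
      (∃ y ∈ Metric.ball x r ∩ P, inner ℝ q (y - x) < (0 : ℝ)) → IsOutwardNormalAt P q x := by
    rintro q hq ⟨y₀, ⟨hy₀, hy₀P⟩, hneg⟩
    have sideq : ∀ y ∈ Metric.ball x r, ∀ z ∈ Metric.ball x r, ∀ k : ℝ, 0 < k →
        inner ℝ q (z - x) = k * inner ℝ q (y - x) → (y ∈ P ↔ z ∈ P) := by
      intro y hy z hz k hk hyz
      refine side y hy z hz k hk ?_
      rcases hq with rfl | rfl
      · exact hyz
      · simp only [inner_neg_left] at hyz
        linarith
    have same : ∀ a b : ℝ, a < 0 → b < 0 → 0 < b / a ∧ b = b / a * a := fun a b ha hb =>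
      ⟨div_pos_of_neg_of_neg hb ha, by field_simp [ha.ne]⟩
    have hle : ∀ y ∈ Metric.ball x r, inner ℝ q (y - x) ≤ (0 : ℝ) → y ∈ P := by
      intro y hy h
      rcases h.lt_or_eq with h | h
      · obtain ⟨h1, h2⟩ := same _ _ hneg h
        exact (sideq y₀ hy₀ y hy _ h1 h2).1 hy₀P
      · exact (sideq x (Metric.mem_ball_self hr) y hy 1 one_pos (by simp [h])).1 hxP
    refine ⟨by rcases hq with rfl | rfl <;> simp [hp], r, hr, fun y hy => ⟨fun hyP => ?_, hle y hy⟩⟩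
    by_contra! hpos
    refine hx.2 (mem_interior_iff_mem_nhds.2 ?_)
    filter_upwards [Metric.ball_mem_nhds x hr] with z hz
    rcases le_or_gt (inner ℝ q (z - x) : ℝ) 0 with h | h
    · exact hle z hz h
    · refine (sideq y hy z hz (inner ℝ q (z - x) / inner ℝ q (y - x)) (div_pos h hpos) ?_).1 hyP
      field_simp
  have hne : (Metric.ball x r ∩ interior P).Nonempty := by
    have : x ∈ closure (interior P) := by rw [hreg]; exact hxP
    exact mem_closure_iff.1 this _ Metric.isOpen_ball (Metric.mem_ball_self hr)
  have hp0 : p ≠ 0 := by rintro rfl; simp at hp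
  obtain ⟨y, hy, hyn⟩ := exists_mem_open_inner_sub_ne_zero hp0
    (Metric.isOpen_ball.inter isOpen_interior) hne x
  rcases lt_or_gt_of_ne hyn with h | h
  · exact Or.inl (key p (Or.inl rfl) ⟨y, ⟨hy.1, interior_subset hy.2⟩, h⟩)
  · exact Or.inr (key (-p) (Or.inr rfl) ⟨y, ⟨hy.1, interior_subset hy.2⟩, by
      rw [inner_neg_left]; linarith⟩)

/-- A boundary point of a regular closed polyhedral set at which no two transversal constraints are
active is a face point, and its normal is one of finitely many vectors. -/
theorem exists_active_pair_or_normal {S : Finset (Finset (E3 × ℝ))}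
    (hreg : closure (interior (polyUnion S)) = polyUnion S) {x : E3}
    (hx : x ∈ frontier (polyUnion S)) :
    (∃ h ∈ halfSpaces S, ∃ h' ∈ halfSpaces S, inner ℝ h.1 x = h.2 ∧ inner ℝ h'.1 x = h'.2 ∧
      LinearIndependent ℝ ![h.1, h'.1]) ∨
    ∃ n ∈ planeNormals S, IsOutwardNormalAt (polyUnion S) n x := by
  by_contra! hcon
  obtain ⟨hcon1, hcon2⟩ := hcon
  by_cases h0 : ∃ h ∈ halfSpaces S, inner ℝ h.1 x = h.2 ∧ h.1 ≠ 0
  · obtain ⟨h, hh, hhx, hne⟩ := h0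
    have hnorm : ‖h.1‖ ≠ 0 := norm_ne_zero_iff.2 hne
    have := isOutwardNormalAt_of_active_parallel hreg hx (p := ‖h.1‖⁻¹ • h.1)
      (by rw [norm_smul, norm_inv, norm_norm, inv_mul_cancel₀ hnorm]) (by
        intro h' hh' hhx'
        have h2 := hcon1 h hh h' hh' hhx hhx'
        rw [LinearIndependent.pair_iff' hne] at h2
        push Not at h2
        obtain ⟨a, ha⟩ := h2
        refine ⟨a * ‖h.1‖, ?_⟩
        rw [smul_smul, mul_assoc, mul_inv_cancel₀ hnorm, mul_one, ha])
    rcases this with h1 | h1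
    · exact hcon2 _ (Or.inl ⟨h, hh, rfl⟩) h1
    · exact hcon2 _ (Or.inr ⟨h, hh, rfl⟩) h1
  · push Not at h0
    obtain ⟨r, hr, _, H⟩ := exists_ball_polyUnion S x
    have hxP := (isClosed_polyUnion S).frontier_subset hx
    refine hx.2 (mem_interior_iff_mem_nhds.2 ?_)
    filter_upwards [Metric.ball_mem_nhds x hr] with z hz
    refine (H x (Metric.mem_ball_self hr) z hz fun h hh hhx => ?_).1 hxP
    simp [h0 h hh hhx]

theorem finrank_span_pair_orthogonal {a b : E3} (h : LinearIndependent ℝ ![a, b]) :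
    Module.finrank ℝ (Submodule.span ℝ (Set.range ![a, b]))ᗮ = 1 := by
  have h1 := Submodule.finrank_add_finrank_orthogonal (Submodule.span ℝ (Set.range ![a, b]))
  rw [finrank_span_eq_card h] at h1
  simp at h1
  omega

theorem mem_span_pair_orthogonal {a b v : E3} :
    v ∈ (Submodule.span ℝ (Set.range ![a, b]))ᗮ ↔
      inner ℝ a v = (0 : ℝ) ∧ inner ℝ b v = (0 : ℝ) := by
  rw [Submodule.mem_orthogonal]
  constructor
  · intro h
    exact ⟨h a (Submodule.subset_span ⟨0, rfl⟩), h b (Submodule.subset_span ⟨1, rfl⟩)⟩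
  · rintro ⟨h1, h2⟩ u hu
    rw [Submodule.mem_span_range_iff_exists_fun] at hu
    obtain ⟨c, rfl⟩ := hu
    simp [Fin.sum_univ_two, inner_add_left, inner_smul_left, h1, h2]

open MeasureTheory in
/-- A bounded part of the intersection of two transversal planes has finite length. -/
theorem hausdorffMeasure_line_inter_ball_lt_top {h h' : E3 × ℝ}
    (hl : LinearIndependent ℝ ![h.1, h'.1]) (R : ℝ) :
    μH[1] ({x : E3 | inner ℝ h.1 x = h.2 ∧ inner ℝ h'.1 x = h'.2} ∩ Metric.ball 0 R) < ⊤ := by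
  set X := {x : E3 | inner ℝ h.1 x = h.2 ∧ inner ℝ h'.1 x = h'.2} ∩ Metric.ball 0 R with hX
  rcases X.eq_empty_or_nonempty with he | ⟨x₀, hx₀⟩
  · rw [he]; simp
  obtain ⟨⟨d, hd⟩, hd0, hspan⟩ := finrank_eq_one_iff'.1 (finrank_span_pair_orthogonal hl)
  have hd0' : d ≠ 0 := fun h => hd0 (by simpa using h)
  have hdn : 0 < ‖d‖ := norm_pos_iff.2 hd0'
  have hLip : LipschitzWith ‖d‖₊ (fun s : ℝ => x₀ + s • d) := by
    refine LipschitzWith.of_dist_le_mul fun s t => ?_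
    rw [dist_add_left, dist_eq_norm, ← sub_smul, norm_smul, mul_comm, coe_nnnorm, dist_eq_norm]
  have hsub : X ⊆ (fun s : ℝ => x₀ + s • d) '' Set.Icc (-(2 * R / ‖d‖)) (2 * R / ‖d‖) := by
    intro x hx
    have hmem : x - x₀ ∈ (Submodule.span ℝ (Set.range ![h.1, h'.1]))ᗮ := by
      rw [mem_span_pair_orthogonal, inner_sub_right, inner_sub_right, hx.1.1, hx.1.2, hx₀.1.1,
        hx₀.1.2]
      simp
    obtain ⟨c, hc⟩ := hspan ⟨x - x₀, hmem⟩
    have hc' : c • d = x - x₀ := by simpa using congrArg Subtype.val hc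
    refine ⟨c, abs_le.1 ?_, by simp [hc']⟩
    rw [le_div_iff₀ hdn, ← Real.norm_eq_abs, ← norm_smul, hc']
    have h1 := hx.2
    have h2 := hx₀.2
    rw [mem_ball_zero_iff] at h1 h2
    linarith [norm_sub_le x x₀]
  refine (measure_mono hsub).trans_lt ?_
  refine (hLip.hausdorffMeasure_image_le zero_le_one _).trans_lt ?_
  rw [hausdorffMeasure_real]
  simp [ENNReal.mul_lt_top]

open MeasureTheory in
/-- The skeleton of a polyhedron has finite length. -/
theorem IsPolyhedron.hausdorffMeasure_skeleton_lt_top {P : Set E3} (hP : IsPolyhedron P) :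
    μH[1] (skeleton P) < ⊤ := by
  obtain ⟨S, hS⟩ := hP.polyhedral
  change P = polyUnion S at hS
  obtain ⟨R, hR⟩ := hP.bounded.subset_ball 0
  let I : Set ((E3 × ℝ) × (E3 × ℝ)) :=
    {q | q ∈ halfSpaces S ×ˢ halfSpaces S ∧ LinearIndependent ℝ ![q.1.1, q.2.1]}
  have hI : I.Finite := ((finite_halfSpaces S).prod (finite_halfSpaces S)).subset fun q hq => hq.1
  have hsub : skeleton P ⊆ ⋃ q ∈ I,
      ({x : E3 | inner ℝ q.1.1 x = q.1.2 ∧ inner ℝ q.2.1 x = q.2.2} ∩ Metric.ball 0 R) := by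
    intro x hx
    have hreg := hP.regular
    rw [hS] at hx hR hreg
    rcases exists_active_pair_or_normal hreg hx.1 with ⟨h, hh, h', hh', e, e', hl⟩ | ⟨n, _, hn⟩
    · refine Set.mem_iUnion₂.2 ⟨(h, h'), ⟨⟨hh, hh'⟩, hl⟩, ⟨e, e'⟩, hR ?_⟩
      exact (isClosed_polyUnion S).frontier_subset hx.1
    · exact absurd ⟨n, hn⟩ hx.2
  refine (measure_mono hsub).trans_lt (measure_biUnion_lt_top hI fun q hq => ?_)
  exact hausdorffMeasure_line_inter_ball_lt_top hq.2 R

open MeasureTheory in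
/-- Finitely many proper subspaces do not cover a nonempty open set. -/
theorem exists_mem_open_notMem_submodules {ι : Type*} {I : Set ι} (hI : I.Finite)
    (K : ι → Submodule ℝ E3) (hK : ∀ i ∈ I, K i ≠ ⊤) {O : Set E3} (hO : IsOpen O)
    (hne : O.Nonempty) : ∃ w ∈ O, ∀ i ∈ I, w ∉ K i := by
  by_contra! hcon
  have h1 : O ⊆ ⋃ i ∈ I, (K i : Set E3) := fun w hw => by
    obtain ⟨i, hi, hwi⟩ := hcon w hw
    exact Set.mem_iUnion₂.2 ⟨i, hi, hwi⟩
  have h2 : volume (⋃ i ∈ I, (K i : Set E3)) = 0 :=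
    (measure_biUnion_null_iff hI.countable).2 fun i hi => Measure.addHaar_submodule _ _ (hK i hi)
  exact (hO.measure_pos volume hne).ne' (measure_mono_null h1 h2)

/-! ### The cone at an exposed vertex -/

/-- The closed convex cone of the vectors making a nonacute angle with every element of `N`. -/
def polarCone (N : Set E3) : Set E3 := {v | ∀ n ∈ N, inner ℝ n v ≤ 0}

/-- In the ball of radius `r` about `H`, the set `P` agrees with a solid convex polyhedral cone
with apex `H`, namely the one whose finitely many unit outward normals form the set `N`. -/
structure IsCorner (P : Set E3) (H : E3) (r : ℝ) (N : Set E3) : Prop where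
  pos : 0 < r
  finite : N.Finite
  norm_eq_one : ∀ n ∈ N, ‖n‖ = 1
  mem_iff : ∀ v : E3, ‖v‖ < r → (H + v ∈ P ↔ v ∈ polarCone N)
  exists_neg : ∃ w : E3, ∀ n ∈ N, inner ℝ n w < 0

/-- In the ball of radius `r` about `H`, the set `P` is invariant under homotheties about `H`. -/
def IsConeNear (P : Set E3) (H : E3) (r : ℝ) : Prop :=
  ∀ v : E3, ∀ k : ℝ, 0 < k → ‖v‖ < r → ‖k • v‖ < r → (H + v ∈ P ↔ H + k • v ∈ P)

theorem smul_mem_polarCone_iff {N : Set E3} {v : E3} {k : ℝ} (hk : 0 < k) :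
    k • v ∈ polarCone N ↔ v ∈ polarCone N := by
  refine forall₂_congr fun n _ => ?_
  rw [inner_smul_right]
  exact ⟨fun h' => nonpos_of_mul_nonpos_right h' hk,
    fun h' => mul_nonpos_of_nonneg_of_nonpos hk.le h'⟩

theorem IsCorner.isConeNear {P : Set E3} {H : E3} {r : ℝ} {N : Set E3} (h : IsCorner P H r N) :
    IsConeNear P H r := fun v k hk hv hkv => by
  rw [h.mem_iff v hv, h.mem_iff _ hkv, smul_mem_polarCone_iff hk]

theorem eventually_norm_add_lt {v : E3} {r : ℝ} (hv : ‖v‖ < r) :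
    ∀ᶠ u in 𝓝 (0 : E3), ‖v + u‖ < r := by
  have : Continuous fun u : E3 => ‖v + u‖ := by fun_prop
  exact this.continuousAt.eventually_lt continuousAt_const (by simpa using hv)

theorem IsConeNear.sameGerm {P : Set E3} {H v : E3} {r k : ℝ} (h : IsConeNear P H r) (hk : 0 < k)
    (hv : ‖v‖ < r) (hkv : ‖k • v‖ < r) : SameGerm k P (H + v) P (H + k • v) := by
  refine ⟨hk, ?_⟩
  filter_upwards [eventually_norm_add_lt hv,
    (tendsto_smul_nhds_zero k).eventually (eventually_norm_add_lt hkv)] with u h1 h2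
  rw [add_assoc, add_assoc, ← smul_add]
  exact h _ k hk h1 (by rwa [smul_add])

/-- If `B` is invariant under homotheties about `H` inside a ball, then the part of a ray from `H`
inside this ball does not leave its component of `B`. -/
theorem smul_mem_connectedComponentIn {B : Set E3} {H v : E3} {r k : ℝ}
    (hB : ∀ j : ℝ, 0 < j → ‖j • v‖ < r → H + j • v ∈ B) (hv : ‖v‖ < r) (hk : 0 < k)
    (hkv : ‖k • v‖ < r) : H + k • v ∈ connectedComponentIn B (H + v) := by
  have hpre : IsPreconnected ((fun j : ℝ => H + j • v) '' Set.uIcc 1 k) :=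
    (convex_uIcc 1 k).isPreconnected.image _ (by fun_prop)
  refine hpre.subset_connectedComponentIn ⟨1, Set.left_mem_uIcc, by simp⟩ ?_
    ⟨k, Set.right_mem_uIcc, rfl⟩
  rintro _ ⟨j, hj, rfl⟩
  have hj0 : 0 < j := lt_of_lt_of_le (lt_min one_pos hk) hj.1
  refine hB j hj0 ?_
  rw [norm_smul, Real.norm_of_nonneg hj0.le]
  rw [norm_smul, Real.norm_of_nonneg hk.le] at hkv
  rcases le_max_iff.1 hj.2 with h | h
  · exact lt_of_le_of_lt (mul_le_of_le_one_left (norm_nonneg _) h) hv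
  · exact lt_of_le_of_lt (mul_le_mul_of_nonneg_right h (norm_nonneg _)) hkv

theorem IsOutwardNormalAt.inner_nonpos {P : Set E3} {n x d : E3} (h : IsOutwardNormalAt P n x)
    (hd : ∀ᶠ s in 𝓝[>] (0 : ℝ), x + s • d ∈ P) : inner ℝ n d ≤ (0 : ℝ) := by
  have h1 : Filter.Tendsto (fun s : ℝ => s • d) (𝓝[>] 0) (𝓝 0) := by
    have : Continuous (fun s : ℝ => s • d) := by fun_prop
    simpa using (this.tendsto 0).mono_left nhdsWithin_le_nhds
  obtain ⟨s, ⟨hs1, hs2⟩, hs3⟩ := ((h1.eventually (isOutwardNormalAt_iff.1 h).2).and hd |>.and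
    self_mem_nhdsWithin).exists
  exact inner_nonpos_of_smul hs3 (hs1.1 hs2)

/-- Where `P` is a convex cone with apex `H`, the half-spaces at its face points contain it and
have `H` on their boundary. -/
theorem IsOutwardNormalAt.of_isConeNear {P : Set E3} {H n v : E3} {r : ℝ}
    (h : IsOutwardNormalAt P n (H + v)) (hcone : IsConeNear P H r) (hHP : H ∈ P)
    (hconv : Convex ℝ (P ∩ Metric.ball H r)) (hv : ‖v‖ < r) :
    inner ℝ n v = (0 : ℝ) ∧ ∀ u : E3, ‖u‖ < r → H + u ∈ P → inner ℝ n u ≤ (0 : ℝ) := by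
  have hvball : H + v ∈ Metric.ball H r := by simpa using hv
  have h1 : ∀ u : E3, ‖u‖ < r → H + u ∈ P → inner ℝ n (u - v) ≤ (0 : ℝ) := by
    intro u hu huP
    refine h.inner_nonpos ?_
    filter_upwards [Ioo_mem_nhdsGT one_pos] with s hs
    have := hconv ⟨h.mem, hvball⟩ ⟨huP, by simpa using hu⟩ (a := 1 - s) (b := s)
      (by linarith [hs.2]) hs.1.le (by ring)
    convert this.1 using 1
    module
  have h2 : inner ℝ n v ≤ (0 : ℝ) := by
    refine h.inner_nonpos ?_
    have hc : Continuous fun s : ℝ => ‖(1 + s) • v‖ := by fun_prop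
    have : ∀ᶠ s in 𝓝[>] (0 : ℝ), ‖(1 + s) • v‖ < r :=
      (hc.continuousAt.eventually_lt continuousAt_const (by simpa using hv)).filter_mono
        nhdsWithin_le_nhds
    filter_upwards [this, self_mem_nhdsWithin] with s hs hs0
    have hs0 : 0 < s := hs0
    have := (hcone v (1 + s) (by linarith) hv hs).1 h.mem
    convert this using 1
    module
  have h3 := h1 0 (by simpa using (norm_nonneg v).trans_lt hv) (by simpa using hHP)
  rw [zero_sub, inner_neg_right] at h3
  have h4 : inner ℝ n v = (0 : ℝ) := by linarith
  refine ⟨h4, fun u hu huP => ?_⟩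
  have := h1 u hu huP
  rwa [inner_sub_right, h4, sub_zero] at this

/-- The face through a face point near `H` contains the ray from that point to `H`, so `H` is in its
closure. -/
theorem IsOutwardNormalAt.mem_gaussVertices {P : Set E3} {H n v : E3} {r : ℝ}
    (h : IsOutwardNormalAt P n (H + v)) (hcone : IsConeNear P H r) (hv : ‖v‖ < r) :
    n ∈ gaussVertices P H := by
  refine ⟨_, h.isFaceNormal, ?_⟩
  have h1 : Filter.Tendsto (fun s : ℝ => H + s • v) (𝓝[>] 0) (𝓝 H) := by
    have : Continuous (fun s : ℝ => H + s • v) := by fun_prop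
    simpa using (this.tendsto 0).mono_left nhdsWithin_le_nhds
  refine mem_closure_of_tendsto h1 ?_
  filter_upwards [Ioo_mem_nhdsGT one_pos] with s hs
  refine smul_mem_connectedComponentIn (r := r) (fun j hj hjr => ?_) hv hs.1 ?_
  · exact (hcone.sameGerm hj hv hjr).mem_facePoints ⟨n, h⟩
  · rw [norm_smul, Real.norm_of_nonneg hs.1.le]
    exact lt_of_le_of_lt (mul_le_of_le_one_left (norm_nonneg _) hs.2.le) hv

theorem inner_neg_of_mem_interior {n w : E3} (hn : ‖n‖ = 1) {X : Set E3} (hw : w ∈ interior X)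
    (h : ∀ u ∈ X, inner ℝ n u ≤ (0 : ℝ)) : inner ℝ n w < (0 : ℝ) := by
  have hc : Continuous fun s : ℝ => w + s • n := by fun_prop
  have h1 : ∀ᶠ s in 𝓝[>] (0 : ℝ), w + s • n ∈ X := by
    refine Filter.Eventually.filter_mono nhdsWithin_le_nhds ?_
    exact hc.continuousAt.eventually_mem (by simpa using mem_interior_iff_mem_nhds.1 hw)
  obtain ⟨s, hs, hs0⟩ := (h1.and self_mem_nhdsWithin).exists
  have hs0 : 0 < s := hs0
  have := h _ hs
  rw [inner_add_right, inner_smul_right, real_inner_self_eq_norm_sq, hn] at this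
  linarith

/-- A connected set meeting a set and its complement meets its frontier. -/
theorem inter_frontier_nonempty {X : Type*} [TopologicalSpace X] {s t : Set X}
    (ht : IsPreconnected t) (hs : (t ∩ s).Nonempty) (hsc : (t ∩ sᶜ).Nonempty) :
    (t ∩ frontier s).Nonempty := by
  by_contra hcon
  have hno : ∀ x ∈ t, x ∉ frontier s := fun x hx hxs => hcon ⟨x, hx, hxs⟩
  have hcover : t ⊆ interior s ∪ (closure s)ᶜ := fun x hx => by
    by_cases h : x ∈ closure s
    · exact Or.inl (by_contra fun h' => hno x hx ⟨h, h'⟩)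
    · exact Or.inr h
  obtain ⟨x, hxt, hx⟩ := hs
  obtain ⟨y, hyt, hy⟩ := hsc
  obtain ⟨z, _, hz1, hz2⟩ := ht _ _ isOpen_interior isClosed_closure.isOpen_compl hcover
    ⟨x, hxt, (hcover hxt).resolve_right fun h => h (subset_closure hx)⟩
    ⟨y, hyt, (hcover hyt).resolve_left fun h => hy (interior_subset h)⟩
  exact hz2 (subset_closure (interior_subset hz1))

/-- A point outside a convex polyhedral cone is separated from it by the outward normal at one of
its face points: a segment to this point from a generic point of the cone leaves the cone at a face
point. -/
theorem exists_mem_gaussVertices_inner_pos {S : Finset (Finset (E3 × ℝ))} {H y : E3} {r : ℝ}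
    (hreg : closure (interior (polyUnion S)) = polyUnion S)
    (hact : ∀ h ∈ halfSpaces S, ∀ y ∈ Metric.ball H r, inner ℝ h.1 y = h.2 → inner ℝ h.1 H = h.2)
    (hcone : IsConeNear (polyUnion S) H r) (hHP : H ∈ polyUnion S)
    (hconv : Convex ℝ (polyUnion S ∩ Metric.ball H r)) (hy : ‖y‖ < r) (hyP : H + y ∉ polyUnion S) :
    ∃ n ∈ planeNormals S ∩ gaussVertices (polyUnion S) H, 0 < inner ℝ n y := by
  set P := polyUnion S with hP
  have hr : 0 < r := (norm_nonneg y).trans_lt hy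
  -- Viewed from `H`, the pairs of transversal planes meet in lines; the start `H + w` of the
  -- segment has to avoid the planes spanned by these lines and `H + y`.
  let I : Set ((E3 × ℝ) × (E3 × ℝ)) :=
    {q | q ∈ halfSpaces S ×ˢ halfSpaces S ∧ LinearIndependent ℝ ![q.1.1, q.2.1]}
  have hI : I.Finite := ((finite_halfSpaces S).prod (finite_halfSpaces S)).subset fun q hq => hq.1
  let K : (E3 × ℝ) × (E3 × ℝ) → Submodule ℝ E3 := fun q =>
    (Submodule.span ℝ (Set.range ![q.1.1, q.2.1]))ᗮ ⊔ Submodule.span ℝ {y}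
  have hK : ∀ q ∈ I, K q ≠ ⊤ := by
    intro q hq htop
    have h1 := Submodule.finrank_add_le_finrank_add_finrank
      (Submodule.span ℝ (Set.range ![q.1.1, q.2.1]))ᗮ (Submodule.span ℝ {y})
    have h2 : Module.finrank ℝ (K q) = 3 := by rw [htop]; simp
    have h3 := finrank_span_le_card (R := ℝ) ({y} : Set E3)
    rw [finrank_span_pair_orthogonal hq.2] at h1
    simp only [Set.toFinset_singleton, Finset.card_singleton] at h3
    have h4 : Module.finrank ℝ (K q) ≤ 1 + Module.finrank ℝ (Submodule.span ℝ {y}) := h1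
    omega
  have hne : ((fun v => H + v) ⁻¹' interior P ∩ Metric.ball 0 r).Nonempty := by
    have hmem : H ∈ closure (interior P) := by rw [hreg]; exact hHP
    obtain ⟨z, hz1, hz2⟩ := mem_closure_iff.1 hmem _ Metric.isOpen_ball (Metric.mem_ball_self hr)
    exact ⟨z - H, by simpa using hz2, by simpa [dist_eq_norm] using hz1⟩
  obtain ⟨w, ⟨hwP, hwr⟩, hwK⟩ := exists_mem_open_notMem_submodules hI K hK
    ((isOpen_interior.preimage (by fun_prop)).inter Metric.isOpen_ball) hne
  rw [mem_ball_zero_iff] at hwr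
  have hseg : (segment ℝ (H + w) (H + y) ∩ frontier P).Nonempty :=
    inter_frontier_nonempty (convex_segment _ _).isPreconnected
      ⟨_, left_mem_segment _ _ _, interior_subset hwP⟩ ⟨_, right_mem_segment _ _ _, hyP⟩
  obtain ⟨x, ⟨a, b, ha, hb, hab, rfl⟩, hx⟩ := hseg
  have hxeq : a • (H + w) + b • (H + y) = H + (a • w + b • y) := by
    have : a • (H + w) + b • (H + y) = (a + b) • H + (a • w + b • y) := by module
    rw [this, hab, one_smul]
  rw [hxeq] at hx
  have hxr : ‖a • w + b • y‖ < r := by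
    have := convex_ball (0 : E3) r (mem_ball_zero_iff.2 hwr) (mem_ball_zero_iff.2 hy) ha hb hab
    exact mem_ball_zero_iff.1 this
  have ha0 : a ≠ 0 := by
    rintro rfl
    have : b = 1 := by linarith
    subst this
    exact hyP (by simpa using (isClosed_polyUnion S).frontier_subset hx)
  rcases exists_active_pair_or_normal hreg hx with ⟨h, hh, h', hh', e, e', hl⟩ | ⟨n, hnS, hn⟩
  · exfalso
    have hxball : H + (a • w + b • y) ∈ Metric.ball H r := by simpa using hxr
    have f := hact h hh _ hxball e
    have f' := hact h' hh' _ hxball e'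
    rw [inner_add_right, f, add_eq_left] at e
    rw [inner_add_right, f', add_eq_left] at e'
    refine hwK (h, h') ⟨⟨hh, hh'⟩, hl⟩ ?_
    have h1 : a • w + b • y ∈ K (h, h') :=
      Submodule.mem_sup_left (mem_span_pair_orthogonal.2 ⟨e, e'⟩)
    have h2 : y ∈ K (h, h') := Submodule.mem_sup_right (Submodule.mem_span_singleton_self y)
    have h3 : a • w ∈ K (h, h') := by
      have := (K (h, h')).sub_mem h1 ((K (h, h')).smul_mem b h2)
      simpa using this
    exact ((K (h, h')).smul_mem_iff ha0).1 h3
  · refine ⟨n, ⟨hnS, hn.mem_gaussVertices hcone hxr⟩, ?_⟩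
    obtain ⟨h1, h2⟩ := hn.of_isConeNear hcone hHP hconv hxr
    have h3 : inner ℝ n w < (0 : ℝ) := by
      refine inner_neg_of_mem_interior hn.1 (X := (fun v => H + v) ⁻¹' interior P ∩
        Metric.ball 0 r) ?_ fun u hu => ?_
      · rw [((isOpen_interior.preimage (by fun_prop)).inter Metric.isOpen_ball).interior_eq]
        exact ⟨hwP, mem_ball_zero_iff.2 hwr⟩
      · exact h2 u (mem_ball_zero_iff.1 hu.2) (interior_subset hu.1)
    rw [inner_add_right, inner_smul_right, inner_smul_right] at h1
    have ha' : 0 < a := lt_of_le_of_ne ha (Ne.symm ha0)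
    have h4 : 0 < b * inner ℝ n y := by nlinarith
    exact pos_of_mul_pos_right h4 hb

theorem isClosed_polarCone (N : Set E3) : IsClosed (polarCone N) := by
  have : polarCone N = ⋂ n ∈ N, {v | inner ℝ n v ≤ (0 : ℝ)} := by ext; simp [polarCone]
  rw [this]
  exact isClosed_biInter fun n _ => isClosed_le (by fun_prop) continuous_const

theorem isOpen_setOf_inner_neg {N : Set E3} (hN : N.Finite) :
    IsOpen {v : E3 | ∀ n ∈ N, inner ℝ n v < (0 : ℝ)} := by
  have : {v : E3 | ∀ n ∈ N, inner ℝ n v < (0 : ℝ)} = ⋂ n ∈ N, {v | inner ℝ n v < (0 : ℝ)} := by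
    ext; simp
  rw [this]
  exact hN.isOpen_biInter fun n _ => isOpen_lt (by fun_prop) continuous_const

/-- Near an exposed vertex, a polyhedron is the cone polar to the finite set of its face normals. -/
theorem IsExposedVertex.exists_isCorner {P : Set E3} (hP : IsPolyhedron P) {H : E3}
    (hH : IsExposedVertex P H) : ∃ r, IsCorner P H r (gaussVertices P H) := by
  obtain ⟨S, hS⟩ := hP.polyhedral
  change P = polyUnion S at hS
  obtain ⟨hHv, U, hU, hHU, hUconv⟩ := hH
  have hreg := hP.regular
  have hHf : H ∈ frontier P := hHv.1.1
  clear hP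
  subst hS
  have hHP : H ∈ polyUnion S := (isClosed_polyUnion S).frontier_subset hHf
  obtain ⟨r₁, hr₁, hact₁, hcone₁⟩ := exists_ball_cone S H
  obtain ⟨r₂, hr₂, hball⟩ := Metric.isOpen_iff.1 hU H hHU
  obtain ⟨r, hr, hrr₁, hrr₂⟩ : ∃ r, 0 < r ∧ r ≤ r₁ ∧ r ≤ r₂ :=
    ⟨min r₁ r₂, lt_min hr₁ hr₂, min_le_left _ _, min_le_right _ _⟩
  have hact : ∀ h ∈ halfSpaces S, ∀ y ∈ Metric.ball H r, inner ℝ h.1 y = h.2 →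
      inner ℝ h.1 H = h.2 := fun h hh y hy => hact₁ h hh y (Metric.ball_subset_ball hrr₁ hy)
  have hcone : IsConeNear (polyUnion S) H r := fun v k hk hv hkv =>
    hcone₁ v k hk (hv.trans_le hrr₁) (hkv.trans_le hrr₁)
  have hconv : Convex ℝ (polyUnion S ∩ Metric.ball H r) := by
    have : polyUnion S ∩ Metric.ball H r = (U ∩ polyUnion S) ∩ Metric.ball H r := by
      ext x
      have := fun hx : x ∈ Metric.ball H r => hball (Metric.ball_subset_ball hrr₂ hx)
      simp only [Set.mem_inter_iff]
      tauto
    rw [this]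
    exact hUconv.inter (convex_ball H r)
  have hsep := fun y => exists_mem_gaussVertices_inner_pos (y := y) hreg hact hcone hHP hconv
  -- every Gauss vertex is the normal at a face point near `H`
  have hnear : ∀ n ∈ gaussVertices (polyUnion S) H, ∃ v : E3, ‖v‖ < r ∧
      IsOutwardNormalAt (polyUnion S) n (H + v) := by
    rintro n ⟨F, hF, hHF⟩
    obtain ⟨x, hx1, hx2⟩ := mem_closure_iff.1 hHF _ Metric.isOpen_ball (Metric.mem_ball_self hr)
    exact ⟨x - H, by simpa [dist_eq_norm] using hx1, by simpa using hF.2 x hx2⟩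
  have hle : ∀ n ∈ gaussVertices (polyUnion S) H, ∀ u : E3, ‖u‖ < r → H + u ∈ polyUnion S →
      inner ℝ n u ≤ (0 : ℝ) := by
    intro n hn
    obtain ⟨v, hv, hnv⟩ := hnear n hn
    exact (hnv.of_isConeNear hcone hHP hconv hv).2
  have hunit : ∀ n ∈ gaussVertices (polyUnion S) H, ‖n‖ = 1 := fun n hn =>
    let ⟨_, _, hnv⟩ := hnear n hn
    hnv.1
  -- every Gauss vertex is orthogonal to one of the planes defining the polyhedron
  have hsub : gaussVertices (polyUnion S) H ⊆ planeNormals S := by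
    intro n hn
    obtain ⟨v, hv, hnv⟩ := hnear n hn
    have hfr := facePoints_subset_frontier _ ⟨n, hnv⟩
    obtain ⟨n', hn', h0⟩ : ∃ n' ∈ planeNormals S ∩ gaussVertices (polyUnion S) H,
        0 ≤ (inner ℝ n' v : ℝ) := by
      by_contra! hcon
      refine hfr.2 (mem_interior_iff_mem_nhds.2 (eventually_nhds_iff_add.2 ?_))
      have hopen := isOpen_setOf_inner_neg ((finite_planeNormals S).inter_of_left
        (gaussVertices (polyUnion S) H))
      filter_upwards [eventually_nhds_iff_add.1 (hopen.mem_nhds hcon),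
        eventually_norm_add_lt hv] with u hu hur
      by_contra hnot
      rw [add_assoc] at hnot
      obtain ⟨m, hm, hpos⟩ := hsep _ hur hnot
      exact lt_asymm hpos (hu m hm)
    have h1 : inner ℝ n' v = (0 : ℝ) := le_antisymm (hle n' hn'.2 v hv hnv.mem) h0
    have : n = n' := by
      refine hnv.eq_of_eventually (hunit n' hn'.2) ?_
      filter_upwards [eventually_norm_add_lt hv] with u hur huP
      rw [add_assoc] at huP
      have := hle n' hn'.2 _ hur huP
      rwa [inner_add_right, h1, zero_add] at this
    rw [this]
    exact hn'.1
  refine ⟨r, hr, (finite_planeNormals S).subset hsub, hunit, fun v hv => ⟨fun hvP n hn =>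
    hle n hn v hv hvP, fun hvN => ?_⟩, ?_⟩
  · by_contra hnot
    obtain ⟨n, hn, hpos⟩ := hsep v hv hnot
    exact absurd (hvN n hn.2) hpos.not_ge
  · have hmem : H ∈ closure (interior (polyUnion S)) := by rw [hreg]; exact hHP
    obtain ⟨z, hz1, hz2⟩ := mem_closure_iff.1 hmem _ Metric.isOpen_ball (Metric.mem_ball_self hr)
    refine ⟨z - H, fun n hn => ?_⟩
    have hopen : IsOpen ((fun v => H + v) ⁻¹' interior (polyUnion S) ∩ Metric.ball 0 r) :=
      (isOpen_interior.preimage (by fun_prop)).inter Metric.isOpen_ball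
    refine inner_neg_of_mem_interior (hunit n hn) (X := (fun v => H + v) ⁻¹' interior
      (polyUnion S) ∩ Metric.ball 0 r) ?_ fun u hu => ?_
    · rw [hopen.interior_eq]
      exact ⟨by simpa using hz2, by simpa [dist_eq_norm] using hz1⟩
    · exact hle n hn u (mem_ball_zero_iff.1 hu.2) (interior_subset hu.1)

/-- The normals at a vertex span: the polyhedron is invariant along any direction orthogonal to all
of them. -/
theorem IsCorner.exists_inner_ne_zero {P : Set E3} {H : E3} {r : ℝ} {N : Set E3}
    (h : IsCorner P H r N) (hH : H ∈ vertices P) {d : E3} (hd : d ≠ 0) :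
    ∃ n ∈ N, inner ℝ n d ≠ (0 : ℝ) := by
  by_contra! hcon
  refine hH.2 ⟨hH.1, d, hd, r, h.pos, fun y hy s hys => ?_⟩
  have h1 := h.mem_iff (y - H) (by simpa [dist_eq_norm] using hy)
  have h2 := h.mem_iff (y + s • d - H) (by simpa [dist_eq_norm] using hys)
  rw [add_sub_cancel] at h1 h2
  rw [h1, h2]
  refine forall₂_congr fun n hn => ?_
  rw [show y + s • d - H = (y - H) + s • d by abel, inner_add_right, inner_smul_right, hcon n hn]
  simp

/-! ### The Gauss image and its incenter -/

/-- The convex cone, without its apex, over the convex hull of `N`. -/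
noncomputable def coneOver (N : Set E3) : ConvexCone ℝ E3 := ConvexCone.hull ℝ (convexHull ℝ N)

theorem mem_coneOver {N : Set E3} {y : E3} :
    y ∈ coneOver N ↔ ∃ a : ℝ, 0 < a ∧ ∃ z ∈ convexHull ℝ N, a • z = y := by
  rw [coneOver, ConvexCone.mem_hull_of_convex (convex_convexHull ℝ N)]
  simp only [Set.mem_smul_set]

theorem convexHull_subset_coneOver (N : Set E3) : convexHull ℝ N ⊆ coneOver N :=
  ConvexCone.subset_hull

theorem inner_neg_of_mem_coneOver {N : Set E3} {w : E3} (hw : ∀ n ∈ N, inner ℝ n w < (0 : ℝ))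
    {y : E3} (hy : y ∈ coneOver N) : inner ℝ y w < (0 : ℝ) := by
  obtain ⟨a, ha, z, hz, rfl⟩ := mem_coneOver.1 hy
  have hconv : Convex ℝ {z : E3 | inner ℝ z w < (0 : ℝ)} := by
    have h : {z : E3 | inner ℝ z w < (0 : ℝ)} = {z : E3 | innerₛₗ ℝ w z < (0 : ℝ)} := by
      ext z; simp [real_inner_comm]
    rw [h]
    exact convex_halfSpace_lt (LinearMap.isLinear _) 0
  have : inner ℝ z w < (0 : ℝ) := convexHull_min hw hconv hz
  rw [inner_smul_left]
  exact mul_neg_of_pos_of_neg ha this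

theorem inner_nonpos_of_mem_coneOver {N : Set E3} {v : E3} (hv : v ∈ polarCone N)
    {y : E3} (hy : y ∈ coneOver N) : inner ℝ y v ≤ (0 : ℝ) := by
  obtain ⟨a, ha, z, hz, rfl⟩ := mem_coneOver.1 hy
  have hconv : Convex ℝ {z : E3 | inner ℝ z v ≤ (0 : ℝ)} := by
    have h : {z : E3 | inner ℝ z v ≤ (0 : ℝ)} = {z : E3 | innerₛₗ ℝ v z ≤ (0 : ℝ)} := by
      ext z; simp [real_inner_comm]
    rw [h]
    exact convex_halfSpace_le (LinearMap.isLinear _) 0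
  have : inner ℝ z v ≤ (0 : ℝ) := convexHull_min hv hconv hz
  rw [inner_smul_left]
  exact mul_nonpos_of_nonneg_of_nonpos ha.le this

/-- The sides of the Gauss image add nothing to the cone over its vertices. -/
theorem gaussImage_eq (P : Set E3) (H : E3) :
    gaussImage P H =
      {y | ‖y‖ = 1 ∧ y ∈ coneOver (gaussVertices P H)} := by
  set K := coneOver (gaussVertices P H) with hK
  have hV : gaussVertices P H ⊆ K := fun n hn =>
    convexHull_subset_coneOver _ (subset_convexHull ℝ _ hn)
  have hsub : convexHull ℝ (gaussVertices P H ∪ gaussEdges P H) ⊆ K := by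
    refine convexHull_min (Set.union_subset hV ?_) K.convex
    rintro y ⟨F, F', e, n, n', hn, hn', -, he, hHe, heF, heF', hy, a, b, ha, hb, rfl⟩
    have h1 : n ∈ K := hV ⟨F, hn, closure_minimal heF isClosed_closure hHe⟩
    have h2 : n' ∈ K := hV ⟨F', hn', closure_minimal heF' isClosed_closure hHe⟩
    rcases ha.eq_or_lt with rfl | ha
    · rcases hb.eq_or_lt with rfl | hb
      · simp at hy
      · simpa using K.smul_mem hb h2
    · rcases hb.eq_or_lt with rfl | hb
      · simpa using K.smul_mem ha h1
      · exact K.add_mem (K.smul_mem ha h1) (K.smul_mem hb h2)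
  ext y
  constructor
  · rintro ⟨hy, a, ha, z, hz, rfl⟩
    exact ⟨hy, K.smul_mem ha (hsub hz)⟩
  · rintro ⟨hy, hyK⟩
    obtain ⟨a, ha, z, hz, rfl⟩ := mem_coneOver.1 hyK
    exact ⟨hy, a, ha, z, convexHull_mono Set.subset_union_left hz, rfl⟩

/-- The cone over a compact convex set not containing the origin meets the unit sphere in the radial
projection of this set. -/
theorem isClosed_unit_coneOver {N : Set E3} (hN : N.Finite) {w : E3}
    (hw : ∀ n ∈ N, inner ℝ n w < (0 : ℝ)) :
    IsClosed {y : E3 | ‖y‖ = 1 ∧ y ∈ coneOver N} := by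
  have h0 : ∀ z ∈ convexHull ℝ N, z ≠ 0 := by
    rintro z hz rfl
    have := inner_neg_of_mem_coneOver hw (convexHull_subset_coneOver N hz)
    simp at this
  have himg : {y : E3 | ‖y‖ = 1 ∧ y ∈ coneOver N} =
      (fun z : E3 => ‖z‖⁻¹ • z) '' convexHull ℝ N := by
    ext y
    constructor
    · rintro ⟨hy, hyK⟩
      obtain ⟨a, ha, z, hz, rfl⟩ := mem_coneOver.1 hyK
      refine ⟨z, hz, ?_⟩
      rw [norm_smul, Real.norm_of_nonneg ha.le] at hy
      change ‖z‖⁻¹ • z = a • z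
      rw [eq_inv_of_mul_eq_one_left hy]
    · rintro ⟨z, hz, rfl⟩
      have hz0 := norm_pos_iff.2 (h0 z hz)
      refine ⟨?_, mem_coneOver.2 ⟨‖z‖⁻¹, inv_pos.2 hz0, z, hz, rfl⟩⟩
      simp [norm_smul, hz0.ne']
  rw [himg]
  refine (hN.isCompact_convexHull ℝ |>.image_of_continuousOn ?_).isClosed
  exact (continuousOn_id.norm.inv₀ fun z hz => norm_ne_zero_iff.2 (h0 z hz)).smul continuousOn_id

/-- A chord of the unit sphere is at most as long as its arc. -/
theorem norm_sub_le_angle {c y : E3} (hc : ‖c‖ = 1) (hy : ‖y‖ = 1) :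
    ‖y - c‖ ≤ InnerProductGeometry.angle c y := by
  have h1 : Real.cos (InnerProductGeometry.angle c y) = inner ℝ c y := by
    rw [InnerProductGeometry.cos_angle, hc, hy]; simp
  have h2 := Real.one_sub_sq_div_two_le_cos (x := InnerProductGeometry.angle c y)
  have h3 : ‖y - c‖ ^ 2 = 2 - 2 * inner ℝ c y := by
    rw [norm_sub_sq_real, hc, hy, real_inner_comm]; ring
  refine le_of_sq_le_sq ?_ (InnerProductGeometry.angle_nonneg _ _)
  rw [h3, ← h1]; linarith

/-- The spherical polygon with vertices in a spanning set contains a disc. -/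
theorem exists_sphericalDisc_subset {N : Set E3}
    (hspan : ∀ d : E3, d ≠ 0 → ∃ n ∈ N, inner ℝ n d ≠ (0 : ℝ)) :
    ∃ ρ > 0, ∃ c : E3, ‖c‖ = 1 ∧
      sphericalDisc c ρ ⊆ {y | ‖y‖ = 1 ∧ y ∈ coneOver N} := by
  have htop : Submodule.span ℝ N = ⊤ := by
    rw [← Submodule.orthogonal_eq_bot_iff, Submodule.eq_bot_iff]
    intro d hd
    by_contra hne
    obtain ⟨n, hn, h⟩ := hspan d hne
    exact h ((Submodule.mem_orthogonal _ _).1 hd n (Submodule.subset_span hn))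
  have hNne : N.Nonempty := by
    obtain ⟨d, hd⟩ := exists_ne (0 : E3)
    obtain ⟨n, hn, _⟩ := hspan d hd
    exact ⟨n, hn⟩
  have hint : (interior (convexHull ℝ (insert 0 N))).Nonempty := by
    rw [interior_convexHull_nonempty_iff_affineSpan_eq_top, ← SetLike.coe_set_eq,
      affineSpan_insert_zero, htop]
    rfl
  have hint' : (interior (convexHull ℝ (insert 0 N)) ∩ {0}ᶜ).Nonempty := by
    refine (dense_compl_singleton (0 : E3)).inter_open_nonempty _ isOpen_interior hint
  obtain ⟨z, hz, hz0⟩ := hint'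
  have hzn : 0 < ‖z‖ := norm_pos_iff.2 hz0
  have hK : ∀ u ∈ convexHull ℝ (insert 0 N), u ≠ 0 → u ∈ coneOver N := by
    intro u hu hu0
    rw [convexHull_insert hNne, mem_convexJoin] at hu
    obtain ⟨o, rfl, y, hy, hu⟩ := hu
    obtain ⟨a, b, ha, hb, hab, rfl⟩ := hu
    rw [smul_zero, zero_add] at hu0 ⊢
    have hb0 : b ≠ 0 := fun h => hu0 (by rw [h, zero_smul])
    exact mem_coneOver.2 ⟨b, lt_of_le_of_ne hb hb0.symm, y, hy, rfl⟩
  obtain ⟨ε, hε, hball⟩ := Metric.isOpen_iff.1 isOpen_interior z hz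
  refine ⟨ε / ‖z‖ / 2, by positivity, ‖z‖⁻¹ • z, by simp [norm_smul, hzn.ne'], ?_⟩
  rintro y ⟨hy, hyc⟩
  refine ⟨hy, ?_⟩
  have h1 := (norm_sub_le_angle (by simp [norm_smul, hzn.ne']) hy).trans hyc
  have h2 : ‖z‖ • y ∈ Metric.ball z ε := by
    have : ‖z‖ • y - z = ‖z‖ • (y - ‖z‖⁻¹ • z) := by
      rw [smul_sub, smul_inv_smul₀ hzn.ne']
    rw [Metric.mem_ball, dist_eq_norm, this, norm_smul, norm_norm]
    calc ‖z‖ * ‖y - ‖z‖⁻¹ • z‖ ≤ ‖z‖ * (ε / ‖z‖ / 2) := by gcongr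
      _ = ε / 2 := by field_simp
      _ < ε := by linarith
  have h3 := hK _ (interior_subset (hball h2)) (by
    rw [smul_ne_zero_iff]
    exact ⟨hzn.ne', norm_ne_zero_iff.1 (by rw [hy]; norm_num)⟩)
  simpa [smul_smul, hzn.ne'] using
    (coneOver N).smul_mem (inv_pos.2 hzn) h3

theorem angle_eq_arccos {c y : E3} (hc : ‖c‖ = 1) (hy : ‖y‖ = 1) :
    InnerProductGeometry.angle c y = Real.arccos (inner ℝ c y) := by
  rw [InnerProductGeometry.angle, hc, hy]; simp

/-- A disc in an open hemisphere has radius less than `π / 2`: larger discs contain antipodal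
points. -/
theorem radius_lt_of_sphericalDisc_subset {g : Set E3} {w c : E3} {ρ : ℝ}
    (hg : ∀ y ∈ g, inner ℝ y w < (0 : ℝ)) (hc : ‖c‖ = 1) (hd : sphericalDisc c ρ ⊆ g) :
    ρ < Real.pi / 2 := by
  by_contra! hρ
  obtain ⟨v, hv, hv0⟩ : ∃ v ∈ (ℝ ∙ c)ᗮ, v ≠ 0 := by
    refine Submodule.exists_mem_ne_zero_of_ne_bot fun hbot => ?_
    have h1 := Submodule.finrank_add_finrank_orthogonal (ℝ ∙ c)
    rw [hbot, finrank_span_singleton (norm_ne_zero_iff.1 (by rw [hc]; norm_num))] at h1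
    simp at h1
  have hvn : 0 < ‖v‖ := norm_pos_iff.2 hv0
  have hcv : inner ℝ c v = (0 : ℝ) := Submodule.mem_orthogonal_singleton_iff_inner_right.1 hv
  have hmem : ∀ s : ℝ, ‖s • v‖ = 1 → inner ℝ (s • v) w < (0 : ℝ) := by
    intro s hs
    refine hg _ (hd ⟨hs, ?_⟩)
    rwa [angle_eq_arccos hc hs, inner_smul_right, hcv, mul_zero, Real.arccos_zero]
  have h1 := hmem ‖v‖⁻¹ (by simp [norm_smul, hvn.ne'])
  have h2 := hmem (-‖v‖⁻¹) (by simp [norm_smul, hvn.ne'])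
  rw [neg_smul, inner_neg_left] at h2
  linarith

/-- If a closed region contains the open disc of radius at most `π / 2`, it contains the closed
disc. -/
theorem sphericalDisc_subset_of_open {g : Set E3} (hg : IsClosed g) {c : E3} {ρ : ℝ}
    (hc : ‖c‖ = 1) (hρ0 : 0 < ρ) (hρ : ρ ≤ Real.pi / 2)
    (hopen : ∀ y : E3, ‖y‖ = 1 → InnerProductGeometry.angle c y < ρ → y ∈ g) :
    sphericalDisc c ρ ⊆ g := by
  rintro y ⟨hy, hcy⟩
  rcases hcy.lt_or_eq with h | h
  · exact hopen y hy h
  set q : ℝ := inner ℝ c y with hq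
  have hqcos : q = Real.cos ρ := by
    rw [← h, InnerProductGeometry.cos_angle, hc, hy]; simp [hq]
  have hq0 : 0 ≤ q := hqcos ▸ Real.cos_nonneg_of_mem_Icc ⟨by linarith, hρ⟩
  have hq1 : q < 1 := by
    rw [hqcos, ← Real.cos_zero]
    exact Real.cos_lt_cos_of_nonneg_of_le_pi_div_two le_rfl hρ hρ0
  -- points pushed from `y` towards the centre are in the open disc
  let f : ℝ → E3 := fun ε => ‖y + ε • c‖⁻¹ • (y + ε • c)
  have hnsq : ∀ ε : ℝ, ‖y + ε • c‖ ^ 2 = 1 + 2 * ε * q + ε ^ 2 := by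
    intro ε
    rw [norm_add_sq_real, hy, inner_smul_right, real_inner_comm, ← hq, norm_smul, hc, mul_one,
      Real.norm_eq_abs, sq_abs]
    ring
  have hf : ∀ ε > 0, f ε ∈ g := by
    intro ε hε
    have hpos : 0 < ‖y + ε • c‖ := by
      have : 0 < ‖y + ε • c‖ ^ 2 := by rw [hnsq]; positivity
      exact pos_of_mul_pos_left (by rwa [sq] at this) (norm_nonneg _)
    have hunit : ‖f ε‖ = 1 := by
      simp only [f]
      rw [norm_smul, norm_inv, norm_norm, inv_mul_cancel₀ hpos.ne']
    refine hopen _ hunit ?_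
    rw [← h, angle_eq_arccos hc hunit, angle_eq_arccos hc hy, ← hq]
    have hin : inner ℝ c (f ε) = (q + ε) / ‖y + ε • c‖ := by
      simp only [f]
      rw [inner_smul_right, inner_add_right, inner_smul_right, real_inner_self_eq_norm_sq, hc, ← hq]
      field_simp
    refine Real.arccos_lt_arccos (by linarith) ?_ ?_
    · rw [hin, lt_div_iff₀ hpos]
      refine lt_of_pow_lt_pow_left₀ 2 (by positivity) ?_
      rw [mul_pow, hnsq]
      have : 0 < (1 - q ^ 2) * (2 * ε * q + ε ^ 2) := by
        have : 0 < 1 - q ^ 2 := by nlinarith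
        positivity
      nlinarith
    · exact (real_inner_le_norm _ _).trans (by rw [hc, hunit]; norm_num)
  have hcont : ContinuousAt f 0 := by
    have hc1 : ContinuousAt (fun ε : ℝ => y + ε • c) 0 := by fun_prop
    exact (hc1.norm.inv₀ (by simp [hy])).smul hc1
  have hlim : Filter.Tendsto f (𝓝[>] 0) (𝓝 y) := by
    have : f 0 = y := by simp [f, hy]
    have h1 := hcont.tendsto
    rw [this] at h1
    exact h1.mono_left nhdsWithin_le_nhds
  exact hg.mem_of_tendsto hlim (Filter.eventually_of_mem self_mem_nhdsWithin hf)

/-- A closed region of the sphere lying in an open hemisphere and containing a disc has an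
incenter, and its inradius lies strictly between `0` and `π / 2`. -/
theorem exists_isIncenter {g : Set E3} (hg : IsClosed g) {w : E3}
    (hgw : ∀ y ∈ g, inner ℝ y w < (0 : ℝ)) {ρ₀ : ℝ} (hρ₀ : 0 < ρ₀) {c₀ : E3} (hc₀ : ‖c₀‖ = 1)
    (hd₀ : sphericalDisc c₀ ρ₀ ⊆ g) :
    ∃ c, IsIncenter g c ∧ 0 < inradius g ∧ inradius g < Real.pi / 2 := by
  set T : Set ℝ := {ρ : ℝ | 0 ≤ ρ ∧ ∃ c : E3, ‖c‖ = 1 ∧ sphericalDisc c ρ ⊆ g} with hT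
  -- the pairs of a center and a radius whose open disc lies in `g`
  let Z : Set (ℝ × E3) := Set.Icc 0 (Real.pi / 2) ×ˢ Metric.sphere 0 1 ∩
    {p | ∀ y : E3, ‖y‖ = 1 → y ∉ g → p.1 ≤ Real.arccos (inner ℝ p.2 y)}
  have hZc : IsCompact Z := by
    refine (isCompact_Icc.prod (isCompact_sphere _ _)).inter_right ?_
    have : {p : ℝ × E3 | ∀ y : E3, ‖y‖ = 1 → y ∉ g → p.1 ≤ Real.arccos (inner ℝ p.2 y)} =
        ⋂ y : E3, ⋂ _ : ‖y‖ = 1, ⋂ _ : y ∉ g,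
          {p : ℝ × E3 | p.1 ≤ Real.arccos (inner ℝ p.2 y)} := by
      ext; simp
    rw [this]
    refine isClosed_iInter fun y => isClosed_iInter fun _ => isClosed_iInter fun _ => ?_
    exact isClosed_le continuous_fst (Real.continuous_arccos.comp (by fun_prop))
  have hTZ : ∀ ρ c, 0 ≤ ρ → ‖c‖ = 1 → sphericalDisc c ρ ⊆ g → (ρ, c) ∈ Z := by
    intro ρ c h0 hc hd
    refine ⟨⟨⟨h0, (radius_lt_of_sphericalDisc_subset hgw hc hd).le⟩, by simpa using hc⟩, ?_⟩
    intro y hy hyg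
    by_contra! hlt
    exact hyg (hd ⟨hy, by rw [angle_eq_arccos hc hy]; exact hlt.le⟩)
  obtain ⟨⟨ρ, c⟩, hZ, hmax⟩ := hZc.exists_isMaxOn ⟨_, hTZ ρ₀ c₀ hρ₀.le hc₀ hd₀⟩
    continuous_fst.continuousOn
  have hc : ‖c‖ = 1 := by simpa using hZ.1.2
  have hρ : 0 < ρ := hρ₀.trans_le (hmax (hTZ ρ₀ c₀ hρ₀.le hc₀ hd₀))
  have hdisc : sphericalDisc c ρ ⊆ g := by
    refine sphericalDisc_subset_of_open hg hc hρ hZ.1.1.2 fun y hy hlt => ?_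
    by_contra hyg
    have := hZ.2 y hy hyg
    rw [angle_eq_arccos hc hy] at hlt
    exact absurd this hlt.not_ge
  have hin : inradius g = ρ := by
    refine IsGreatest.csSup_eq ⟨⟨hρ.le, c, hc, hdisc⟩, ?_⟩
    rintro ρ' ⟨h0, c', hc', hd'⟩
    exact hmax (hTZ ρ' c' h0 hc' hd')
  refine ⟨c, ⟨hc, by rwa [hin]⟩, by rwa [hin], ?_⟩
  rw [hin]
  exact radius_lt_of_sphericalDisc_subset hgw hc hdisc

/-- The component of `v` orthogonal to the unit vector `c`. -/
noncomputable def orthComp (c v : E3) : E3 := v - (inner ℝ c v : ℝ) • c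

theorem inner_orthComp {c : E3} (hc : ‖c‖ = 1) (v : E3) : inner ℝ c (orthComp c v) = (0 : ℝ) := by
  rw [orthComp, inner_sub_right, inner_smul_right, real_inner_self_eq_norm_sq, hc]; ring

theorem norm_sq_eq_add_orthComp {c : E3} (hc : ‖c‖ = 1) (v : E3) :
    ‖v‖ ^ 2 = (inner ℝ c v : ℝ) ^ 2 + ‖orthComp c v‖ ^ 2 := by
  rw [orthComp, norm_sub_sq_real, inner_smul_right, real_inner_comm c v, norm_smul, hc, mul_one,
    Real.norm_eq_abs, sq_abs]
  ring

/-- If every point of the disc of radius `θ` about `c` makes a nonacute angle with `v`, then `v`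
makes an angle at most `π / 2 - θ` with `-c`. -/
theorem norm_orthComp_mul_sin_le {c v : E3} {θ : ℝ} (hc : ‖c‖ = 1) (hθ0 : 0 ≤ θ)
    (hθ : θ ≤ Real.pi / 2)
    (h : ∀ y ∈ sphericalDisc c θ, inner ℝ y v ≤ (0 : ℝ)) :
    ‖orthComp c v‖ * Real.sin θ ≤ -inner ℝ c v * Real.cos θ := by
  have hcc : inner ℝ c c = (1 : ℝ) := by rw [real_inner_self_eq_norm_sq, hc]; norm_num
  rcases eq_or_ne (orthComp c v) 0 with h0 | h0
  · rw [h0, norm_zero, zero_mul]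
    have h1 := h c ⟨hc, by
      rw [InnerProductGeometry.angle_self (norm_ne_zero_iff.1 (by rw [hc]; norm_num))]
      exact hθ0⟩
    exact mul_nonneg (by linarith) (Real.cos_nonneg_of_mem_Icc ⟨by linarith [Real.pi_pos], hθ⟩)
  have hpn : 0 < ‖orthComp c v‖ := norm_pos_iff.2 h0
  -- the point of the disc closest to the direction of `v`
  set p := ‖orthComp c v‖⁻¹ • orthComp c v with hp
  have hcp : inner ℝ c p = (0 : ℝ) := by rw [hp, inner_smul_right, inner_orthComp hc, mul_zero]
  have hpnorm : ‖p‖ = 1 := by simp [hp, norm_smul, hpn.ne']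
  have hpv : inner ℝ p v = ‖orthComp c v‖ := by
    have h1 : v = orthComp c v + (inner ℝ c v : ℝ) • c := by simp [orthComp]
    have h2 : inner ℝ p v = (inner ℝ p (orthComp c v) : ℝ) := by
      conv_lhs => rw [h1]
      rw [inner_add_right, inner_smul_right, real_inner_comm c p, hcp, mul_zero, add_zero]
    rw [h2, hp, inner_smul_left, real_inner_self_eq_norm_sq]
    simp only [conj_trivial]
    field_simp
  have hun : ‖Real.cos θ • c + Real.sin θ • p‖ = 1 := by
    have : ‖Real.cos θ • c + Real.sin θ • p‖ ^ 2 = 1 := by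
      rw [norm_add_sq_real, inner_smul_left, inner_smul_right, hcp, norm_smul, norm_smul, hc,
        hpnorm, mul_one, mul_one, Real.norm_eq_abs, Real.norm_eq_abs, sq_abs, sq_abs]
      simp
    exact (pow_eq_one_iff_of_nonneg (norm_nonneg _) two_ne_zero).1 this
  have h1 := h _ ⟨hun, by
    rw [angle_eq_arccos hc hun, inner_add_right, inner_smul_right, inner_smul_right, hcc, hcp,
      mul_one, mul_zero, add_zero, Real.arccos_cos hθ0 (by linarith [Real.pi_pos])]⟩
  rw [inner_add_left, inner_smul_left, inner_smul_left, hpv] at h1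
  simp only [conj_trivial] at h1
  linarith

/-! ### Cutting off a corner -/

/-- A plane at distance `t` from the apex `H`, with unit normal `c`, cutting off from the cone at a
corner of `P` a cap contained in the ball of radius `r / 2`; every vector of the cone makes with
`-c` an angle whose cosine is at least `σ`. -/
structure CornerCut (P : Set E3) (H : E3) (r : ℝ) (N : Set E3) (c : E3) (σ t : ℝ) : Prop where
  corner : IsCorner P H r N
  norm_c : ‖c‖ = 1
  sigma_pos : 0 < σ
  le_depth : ∀ v ∈ polarCone N, σ * ‖v‖ ≤ -inner ℝ c v
  pos : 0 < t
  lt : 2 * t < σ * r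

/-- The part of the cone at `H` strictly above the cutting plane. -/
def openCap (H : E3) (N : Set E3) (c : E3) (t : ℝ) : Set E3 :=
  {x | x - H ∈ polarCone N ∧ -t < inner ℝ c (x - H)}

/-- The part of the cone at `H` above the cutting plane, base included. -/
def closedCap (H : E3) (N : Set E3) (c : E3) (t : ℝ) : Set E3 :=
  {x | x - H ∈ polarCone N ∧ -t ≤ inner ℝ c (x - H)}

/-- The relative interior of the base of the cap. -/
def capFace (H : E3) (N : Set E3) (c : E3) (t : ℝ) : Set E3 :=
  {x | (∀ n ∈ N, inner ℝ n (x - H) < (0 : ℝ)) ∧ inner ℝ c (x - H) = -t}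

/-- The relative boundary of the base of the cap. -/
def capRing (H : E3) (N : Set E3) (c : E3) (t : ℝ) : Set E3 :=
  {x | x - H ∈ polarCone N ∧ inner ℝ c (x - H) = -t ∧ ∃ n ∈ N, inner ℝ n (x - H) = (0 : ℝ)}

theorem openCap_subset_closedCap (H : E3) (N : Set E3) (c : E3) (t : ℝ) :
    openCap H N c t ⊆ closedCap H N c t := fun _ hx => ⟨hx.1, hx.2.le⟩

theorem isClosed_closedCap (H : E3) (N : Set E3) (c : E3) (t : ℝ) :
    IsClosed (closedCap H N c t) :=
  ((isClosed_polarCone N).preimage (by fun_prop : Continuous fun x : E3 => x - H)).inter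
    (isClosed_le continuous_const (by fun_prop : Continuous fun x : E3 => (inner ℝ c (x - H) : ℝ)))

/-- Sets that are finite unions of finite intersections of closed half-spaces. -/
def IsPolyhedral (X : Set E3) : Prop := ∃ S : Finset (Finset (E3 × ℝ)), X = polyUnion S

theorem IsPolyhedral.iUnion {ι : Type*} [Fintype ι] {X : ι → Set E3}
    (h : ∀ i, IsPolyhedral (X i)) : IsPolyhedral (⋃ i, X i) := by
  classical
  choose S hS using h
  refine ⟨Finset.univ.biUnion S, ?_⟩
  ext x
  simp only [hS, Set.mem_iUnion, mem_polyUnion, Finset.mem_biUnion, Finset.mem_univ, true_and]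
  exact ⟨fun ⟨i, s, hs, hx⟩ => ⟨s, ⟨i, hs⟩, hx⟩, fun ⟨s, ⟨i, hs⟩, hx⟩ => ⟨i, s, hs, hx⟩⟩

theorem IsPolyhedral.union {X Y : Set E3} (hX : IsPolyhedral X) (hY : IsPolyhedral Y) :
    IsPolyhedral (X ∪ Y) := by
  rw [Set.union_eq_iUnion]
  exact IsPolyhedral.iUnion fun b => by cases b <;> assumption

theorem IsPolyhedral.inter_halfSpace {X : Set E3} (hX : IsPolyhedral X) (a : E3) (b : ℝ) :
    IsPolyhedral (X ∩ {x | inner ℝ a x ≤ b}) := by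
  classical
  obtain ⟨S, rfl⟩ := hX
  refine ⟨S.image (insert (a, b)), ?_⟩
  ext x
  simp only [Set.mem_inter_iff, mem_polyUnion, Finset.mem_image, Set.mem_ofPred_eq,
    exists_exists_and_eq_and, Finset.forall_mem_insert]
  exact ⟨fun ⟨⟨s, hs, h⟩, hx⟩ => ⟨s, hs, hx, h⟩, fun ⟨s, hs, hx, h⟩ => ⟨⟨s, hs, h⟩, hx⟩⟩

namespace CornerCut

variable {P : Set E3} {H : E3} {r : ℝ} {N : Set E3} {c : E3} {σ t : ℝ}

theorem norm_lt_of_mem (h : CornerCut P H r N c σ t) {v : E3} (hv : v ∈ polarCone N)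
    (hd : -t ≤ inner ℝ c v) : ‖v‖ < r / 2 := by
  have h1 := h.le_depth v hv
  have h2 : σ * ‖v‖ < σ * (r / 2) := by linarith [h.lt]
  exact lt_of_mul_lt_mul_left h2 h.sigma_pos.le

theorem norm_lt (h : CornerCut P H r N c σ t) {x : E3} (hx : x ∈ closedCap H N c t) :
    ‖x - H‖ < r := by
  have := h.norm_lt_of_mem hx.1 hx.2
  linarith [h.corner.pos]

theorem mem_iff (h : CornerCut P H r N c σ t) {x : E3} (hx : ‖x - H‖ < r) :
    x ∈ P ↔ x - H ∈ polarCone N := by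
  rw [← h.corner.mem_iff _ hx, add_sub_cancel]

theorem closedCap_subset (h : CornerCut P H r N c σ t) : closedCap H N c t ⊆ P := fun _ hx =>
  (h.mem_iff (h.norm_lt hx)).2 hx.1

theorem exists_inner_neg (h : CornerCut P H r N c σ t) :
    ∃ w : E3, (∀ n ∈ N, inner ℝ n w < (0 : ℝ)) ∧ inner ℝ c w = (-t : ℝ) := by
  obtain ⟨w, hw⟩ := h.corner.exists_neg
  have hw0 : w ≠ 0 := by
    rintro rfl
    have hc : c ∈ polarCone N := fun n hn => absurd (hw n hn) (by simp)
    have := h.le_depth c hc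
    rw [real_inner_self_eq_norm_sq, h.norm_c] at this
    linarith [h.sigma_pos]
  have h1 := h.le_depth w fun n hn => (hw n hn).le
  have h2 : 0 < -(inner ℝ c w : ℝ) := (mul_pos h.sigma_pos (norm_pos_iff.2 hw0)).trans_le h1
  refine ⟨(t / -(inner ℝ c w : ℝ)) • w, fun n hn => ?_, ?_⟩
  · rw [inner_smul_right]
    exact mul_neg_of_pos_of_neg (div_pos h.pos h2) (hw n hn)
  · rw [inner_smul_right]
    have h3 : (inner ℝ c w : ℝ) ≠ 0 := by linarith
    field_simp

/-- Away from the closed cap, cutting does not change the set. -/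
theorem eventually_mem_iff_of_notMem {x : E3}
    (hx : x ∉ closedCap H N c t) : ∀ᶠ y in 𝓝 x, (y ∈ P ↔ y ∈ P \ openCap H N c t) := by
  filter_upwards [(isClosed_closedCap H N c t).isOpen_compl.mem_nhds hx] with y hy
  exact ⟨fun h' => ⟨h', fun h'' => hy (openCap_subset_closedCap _ _ _ _ h'')⟩, fun h' => h'.1⟩

theorem mem_diff_iff (h : CornerCut P H r N c σ t) {x : E3} (hx : ‖x - H‖ < r) :
    x ∈ P \ openCap H N c t ↔ x - H ∈ polarCone N ∧ inner ℝ c (x - H) ≤ (-t : ℝ) := by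
  rw [Set.mem_sdiff, h.mem_iff hx, openCap, Set.mem_ofPred_eq, not_and, not_lt]
  exact ⟨fun h' => ⟨h'.1, h'.2 h'.1⟩, fun h' => ⟨h'.1, fun _ => h'.2⟩⟩

theorem eventually_norm_lt {x : E3} (hx : ‖x - H‖ < r) : ∀ᶠ y in 𝓝 x, ‖y - H‖ < r := by
  have hc : Continuous fun y : E3 => ‖y - H‖ := by fun_prop
  exact hc.continuousAt.eventually_lt continuousAt_const hx

/-- The cut set is polyhedral: it consists of the points of `P` below the cutting plane and of those
outside a cube around the cap inside which `P` is a cone. -/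
theorem isPolyhedral_diff (h : CornerCut P H r N c σ t) (hP : IsPolyhedral P) :
    IsPolyhedral (P \ openCap H N c t) := by
  have hr := h.corner.pos
  have heq : P \ openCap H N c t = (P ∩ {x | inner ℝ c x ≤ inner ℝ c H - t}) ∪
      ⋃ i : Fin 3, ((P ∩ {x | inner ℝ (EuclideanSpace.single i (1 : ℝ)) x ≤ H i - r / 2}) ∪
        (P ∩ {x | inner ℝ (-EuclideanSpace.single i (1 : ℝ)) x ≤ -(H i + r / 2)})) := by
    ext x
    simp only [Set.mem_union, Set.mem_iUnion, Set.mem_inter_iff, Set.mem_ofPred_eq,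
      inner_neg_left, EuclideanSpace.inner_single_left, map_one, one_mul]
    constructor
    · rintro ⟨hxP, hx⟩
      by_cases hfar : ‖x - H‖ < r
      · left
        have := ((h.mem_diff_iff hfar).1 ⟨hxP, hx⟩).2
        rw [inner_sub_right] at this
        exact ⟨hxP, by linarith⟩
      · right
        by_contra! hcon
        apply hfar
        have hcoord : ∀ i, (x i - H i) ^ 2 ≤ (r / 2) ^ 2 := by
          intro i
          have h1 := (hcon i).1 hxP
          have h2 := (hcon i).2 hxP
          exact sq_le_sq' (by linarith) (by linarith)
        -- the cube of side `r` about `H` has circumradius `√3 / 2 * r < r`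
        refine lt_of_pow_lt_pow_left₀ 2 hr.le ?_
        rw [EuclideanSpace.norm_sq_eq, Fin.sum_univ_three]
        simp only [PiLp.sub_apply, Real.norm_eq_abs, sq_abs]
        nlinarith [hcoord 0, hcoord 1, hcoord 2]
    · have hclose : ∀ i, x ∈ openCap H N c t → |x i - H i| < r / 2 := by
        intro i hx
        refine lt_of_le_of_lt ?_ (h.norm_lt_of_mem hx.1 hx.2.le)
        have := PiLp.norm_apply_le (x - H) i
        simpa using this
      rintro (⟨hxP, hx⟩ | ⟨i, ⟨hxP, hx⟩ | ⟨hxP, hx⟩⟩)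
      · refine ⟨hxP, fun hx' => ?_⟩
        have := hx'.2
        rw [inner_sub_right] at this
        linarith
      · refine ⟨hxP, fun hx' => ?_⟩
        have := abs_lt.1 (hclose i hx')
        linarith [this.1]
      · refine ⟨hxP, fun hx' => ?_⟩
        have := abs_lt.1 (hclose i hx')
        linarith [this.2]
  rw [heq]
  exact (hP.inter_halfSpace _ _).union (IsPolyhedral.iUnion fun i =>
    (hP.inter_halfSpace _ _).union (hP.inter_halfSpace _ _))

theorem isPolyhedron_diff (h : CornerCut P H r N c σ t) (hP : IsPolyhedron P) :
    IsPolyhedron (P \ openCap H N c t) := by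
  obtain ⟨w, hw, hwt⟩ := h.exists_inner_neg
  have hwr : ‖w‖ < r / 2 := h.norm_lt_of_mem (fun n hn => (hw n hn).le) hwt.ge
  have hr := h.corner.pos
  have hpoly := h.isPolyhedral_diff hP.polyhedral
  refine ⟨⟨H + w, ?_⟩, hP.bounded.subset Set.sdiff_subset, ?_, hpoly⟩
  · rw [h.mem_diff_iff (by simpa using by linarith)]
    simpa using ⟨fun n hn => (hw n hn).le, hwt.le⟩
  refine Set.Subset.antisymm ?_ ?_
  · obtain ⟨S, hS⟩ := hpoly
    rw [hS]
    exact (isClosed_polyUnion S).closure_interior_subset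
  · intro x hx
    by_cases hxc : x ∈ closedCap H N c t
    · -- push the point of the base inwards along `w`
      have hxr := h.norm_lt hxc
      have hx' := (h.mem_diff_iff hxr).1 hx
      have hlim : Filter.Tendsto (fun s : ℝ => x + s • w) (𝓝[>] 0) (𝓝 x) := by
        have : Continuous (fun s : ℝ => x + s • w) := by fun_prop
        simpa using (this.tendsto 0).mono_left nhdsWithin_le_nhds
      refine mem_closure_of_tendsto hlim ?_
      filter_upwards [hlim.eventually (eventually_norm_lt hxr), self_mem_nhdsWithin] with s hs hs0
      have hs0 : 0 < s := hs0
      have hneg : ∀ n ∈ N, inner ℝ n (x + s • w - H) < (0 : ℝ) := by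
        intro n hn
        rw [show x + s • w - H = (x - H) + s • w by abel, inner_add_right, inner_smul_right]
        have h1 := hx'.1 n hn
        have h2 := mul_neg_of_pos_of_neg hs0 (hw n hn)
        linarith
      have hdep : inner ℝ c (x + s • w - H) < (-t : ℝ) := by
        rw [show x + s • w - H = (x - H) + s • w by abel, inner_add_right, inner_smul_right, hwt]
        have h1 := hx'.2
        have h2 := mul_pos hs0 h.pos
        linarith
      rw [mem_interior_iff_mem_nhds]
      have hopen := ((isOpen_setOf_inner_neg h.corner.finite).preimage
        (by fun_prop : Continuous fun x : E3 => x - H)).mem_nhds hneg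
      have hc : Continuous fun y : E3 => (inner ℝ c (y - H) : ℝ) := by fun_prop
      filter_upwards [hopen, eventually_norm_lt hs,
        hc.continuousAt.eventually_lt continuousAt_const hdep] with y hy1 hy2 hy3
      exact (h.mem_diff_iff hy2).2 ⟨fun n hn => (hy1 n hn).le, hy3.le⟩
    · have hloc := (isClosed_closedCap H N c t).isOpen_compl.mem_nhds hxc
      have hxP : x ∈ closure (interior P) := by rw [hP.regular]; exact hx.1
      rw [mem_closure_iff_nhds] at hxP ⊢
      intro V hV
      obtain ⟨y, ⟨hyV, hyc⟩, hyP⟩ := hxP _ (Filter.inter_mem hV hloc)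
      refine ⟨y, hyV, ?_⟩
      rw [mem_interior_iff_mem_nhds] at hyP ⊢
      filter_upwards [hyP, eventually_mem_iff_of_notMem (P := P) hyc] with z hz hz'
      exact hz'.1 hz

theorem isClosed_diff (h : CornerCut P H r N c σ t) (hP : IsPolyhedron P) :
    IsClosed (P \ openCap H N c t) := by
  rw [← (h.isPolyhedron_diff hP).regular]
  exact isClosed_closure

theorem sameGerm_of_notMem {x : E3} (hx : x ∉ closedCap H N c t) :
    SameGerm 1 P x (P \ openCap H N c t) x :=
  sameGerm_one_of_eventually (eventually_mem_iff_of_notMem hx)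

/-- On the base of the cap, the cut set is a half-space near interior points. -/
theorem capFace_subset_facePoints (h : CornerCut P H r N c σ t) :
    capFace H N c t ⊆ facePoints (P \ openCap H N c t) := by
  rintro x ⟨hx, hxt⟩
  have hxr := h.norm_lt ⟨fun n hn => (hx n hn).le, hxt.ge⟩
  refine ⟨c, isOutwardNormalAt_iff.2 ⟨h.norm_c, ?_⟩⟩
  have hopen := ((isOpen_setOf_inner_neg h.corner.finite).preimage
    (by fun_prop : Continuous fun x : E3 => x - H)).mem_nhds hx
  filter_upwards [eventually_nhds_iff_add.1 hopen,
    eventually_nhds_iff_add.1 (eventually_norm_lt hxr)] with v hv1 hv2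
  rw [h.mem_diff_iff hv2, show x + v - H = (x - H) + v by abel, inner_add_right, hxt]
  have hv1' : (x - H) + v ∈ polarCone N := fun n hn => by
    have := hv1 n hn
    rw [show x + v - H = (x - H) + v by abel] at this
    exact this.le
  simp [hv1']

/-- The points of the cut set in the closed cap form its base. -/
theorem mem_capFace_or_capRing (h : CornerCut P H r N c σ t) {x : E3}
    (hx : x ∈ P \ openCap H N c t) (hxc : x ∈ closedCap H N c t) :
    x ∈ capFace H N c t ∨ x ∈ capRing H N c t := by
  have h1 := ((h.mem_diff_iff (h.norm_lt hxc)).1 hx).2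
  have h2 : inner ℝ c (x - H) = (-t : ℝ) := le_antisymm h1 hxc.2
  by_cases hex : ∃ n ∈ N, inner ℝ n (x - H) = (0 : ℝ)
  · exact Or.inr ⟨hxc.1, h2, hex⟩
  · push Not at hex
    exact Or.inl ⟨fun n hn => lt_of_le_of_ne (hxc.1 n hn) (hex n hn), h2⟩

/-- On the relative boundary of the base two transversal planes meet. -/
theorem notMem_facePoints_of_mem_capRing (h : CornerCut P H r N c σ t) {x : E3}
    (hx : x ∈ capRing H N c t) : x ∉ facePoints (P \ openCap H N c t) := by
  rintro ⟨m, hm⟩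
  obtain ⟨hxN, hxt, n, hn, hn0⟩ := hx
  have hev := eventually_nhds_iff_add.1 (eventually_norm_lt (h.norm_lt ⟨hxN, hxt.ge⟩))
  have h1 : m = n := hm.eq_of_eventually (h.corner.norm_eq_one n hn) (by
    filter_upwards [hev] with v hv hvP
    have := ((h.mem_diff_iff hv).1 hvP).1 n hn
    rwa [show x + v - H = (x - H) + v by abel, inner_add_right, hn0, zero_add] at this)
  have h2 : m = c := hm.eq_of_eventually h.norm_c (by
    filter_upwards [hev] with v hv hvP
    have := ((h.mem_diff_iff hv).1 hvP).2
    rw [show x + v - H = (x - H) + v by abel, inner_add_right, hxt] at this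
    linarith)
  rw [← h1, h2, hxt] at hn0
  linarith [h.pos]

theorem facePoints_diff (h : CornerCut P H r N c σ t) :
    facePoints (P \ openCap H N c t) =
      (facePoints P \ closedCap H N c t) ∪ capFace H N c t := by
  ext x
  constructor
  · intro hx
    by_cases hxc : x ∈ closedCap H N c t
    · exact Or.inr ((h.mem_capFace_or_capRing (facePoints_subset _ hx) hxc).resolve_right
        fun h' => h.notMem_facePoints_of_mem_capRing h' hx)
    · exact Or.inl ⟨(sameGerm_of_notMem hxc).symm.mem_facePoints hx, hxc⟩
  · rintro (⟨hx, hxc⟩ | hx)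
    · exact (sameGerm_of_notMem hxc).mem_facePoints hx
    · exact h.capFace_subset_facePoints hx

theorem skeleton_diff_subset (h : CornerCut P H r N c σ t) (hP : IsPolyhedron P) :
    skeleton (P \ openCap H N c t) ⊆
      (skeleton P \ closedCap H N c t) ∪ capRing H N c t := by
  intro x hx
  by_cases hxc : x ∈ closedCap H N c t
  · refine Or.inr ((h.mem_capFace_or_capRing ?_ hxc).resolve_left
      fun h' => hx.2 (h.capFace_subset_facePoints h'))
    exact (h.isClosed_diff hP).frontier_subset hx.1
  · exact Or.inl ⟨(sameGerm_of_notMem hxc).symm.mem_skeleton hx, hxc⟩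

end CornerCut

/-! ### Counting faces -/

namespace CornerCut

variable {P : Set E3} {H : E3} {r : ℝ} {N : Set E3} {c : E3} {σ t : ℝ}

theorem smul_mem_face (h : CornerCut P H r N c σ t) {x : E3} (hx : x ∈ facePoints P)
    (hxr : ‖x - H‖ < r) {k : ℝ} (hk : 0 < k) (hkr : ‖k • (x - H)‖ < r) :
    H + k • (x - H) ∈ connectedComponentIn (facePoints P) x := by
  have hcone := h.corner.isConeNear
  have := smul_mem_connectedComponentIn (B := facePoints P) (H := H) (v := x - H) (r := r) (k := k)
    (fun j hj hjr => ?_) hxr hk hkr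
  · rwa [add_sub_cancel] at this
  · have := hcone.sameGerm hj hxr hjr
    rw [add_sub_cancel] at this
    exact this.mem_facePoints hx

/-- A continuous function, positive away from `H`, which is the depth below `H` on the cone at `H`
and is large far from `H`. -/
noncomputable def depth (H c : E3) (σ : ℝ) (x : E3) : ℝ :=
  max (-inner ℝ c (x - H)) (σ * ‖x - H‖)

/-- A radial map pushing the points of `P` in the cap at depth less than `2 * t` below the cutting
plane, and fixing the other points. -/
noncomputable def push (H c : E3) (σ t : ℝ) (x : E3) : E3 :=
  H + max 1 (1 / 2 + t / depth H c σ x) • (x - H)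

theorem depth_pos (h : CornerCut P H r N c σ t) {x : E3} (hx : x ≠ H) : 0 < depth H c σ x :=
  lt_max_of_lt_right (mul_pos h.sigma_pos (norm_pos_iff.2 (sub_ne_zero.2 hx)))

theorem depth_eq (h : CornerCut P H r N c σ t) {x : E3} (hx : x ∈ P) (hxr : ‖x - H‖ < r) :
    depth H c σ x = -inner ℝ c (x - H) :=
  max_eq_left (h.le_depth _ ((h.mem_iff hxr).1 hx))

theorem continuousOn_push (h : CornerCut P H r N c σ t) : ContinuousOn (push H c σ t) {H}ᶜ := by
  have h1 : Continuous (depth H c σ) := by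
    unfold depth
    fun_prop
  unfold push
  have h2 : Continuous fun x : E3 => x - H := by fun_prop
  have h3 : ContinuousOn (fun x => max 1 (1 / 2 + t / depth H c σ x)) {H}ᶜ :=
    ContinuousOn.sup continuousOn_const (continuousOn_const.add
      (continuousOn_const.div h1.continuousOn fun x hx => (h.depth_pos hx).ne'))
  exact continuousOn_const.add (h3.smul h2.continuousOn)

theorem push_eq_self (h : CornerCut P H r N c σ t) {x : E3} (hx : 2 * t ≤ depth H c σ x) :
    push H c σ t x = x := by
  have h0 : 0 < depth H c σ x := by linarith [h.pos]
  have h1 : 1 / 2 + t / depth H c σ x ≤ 1 := by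
    have : t / depth H c σ x ≤ 1 / 2 := by rw [div_le_iff₀ h0]; linarith
    linarith
  rw [push, max_eq_left h1, one_smul, add_sub_cancel]

theorem push_eq_of_le (h : CornerCut P H r N c σ t) {x : E3} (hx : x ≠ H)
    (hd : depth H c σ x ≤ 2 * t) :
    push H c σ t x = H + (1 / 2 + t / depth H c σ x) • (x - H) := by
  have h0 := h.depth_pos hx
  have h1 : 1 ≤ 1 / 2 + t / depth H c σ x := by
    have : 1 / 2 ≤ t / depth H c σ x := by rw [le_div_iff₀ h0]; linarith
    linarith
  rw [push, max_eq_right h1]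

theorem norm_sub_lt_of_depth_lt (h : CornerCut P H r N c σ t) {x : E3}
    (hd : depth H c σ x ≤ 2 * t) : ‖x - H‖ < r := by
  have h1 : σ * ‖x - H‖ < σ * r := (le_max_right _ _).trans_lt (hd.trans_lt h.lt)
  exact lt_of_mul_lt_mul_left h1 h.sigma_pos.le

theorem notMem_closedCap_of_lt_depth (h : CornerCut P H r N c σ t) {x : E3}
    (hd : t < depth H c σ x) : x ∉ closedCap H N c t := by
  intro hx
  have h1 := h.depth_eq (h.closedCap_subset hx) (h.norm_lt hx)
  have := hx.2
  linarith

/-- The radial map carries each face of `P` onto its part outside the closed cap. -/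
theorem image_push (h : CornerCut P H r N c σ t) (hH : H ∉ facePoints P) (x₀ : E3) :
    push H c σ t '' connectedComponentIn (facePoints P) x₀ =
      connectedComponentIn (facePoints P) x₀ \ closedCap H N c t := by
  set F := connectedComponentIn (facePoints P) x₀ with hF
  have hFA : F ⊆ facePoints P := connectedComponentIn_subset _ _
  have hrad : ∀ x ∈ F, ‖x - H‖ < r → ∀ k : ℝ, 0 < k → ‖k • (x - H)‖ < r →
      H + k • (x - H) ∈ F := by
    intro x hx hxr k hk hkr
    have := h.smul_mem_face (hFA hx) hxr hk hkr
    rwa [← connectedComponentIn_eq hx] at this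
  have hneH : ∀ x ∈ F, x ≠ H := fun x hx e => hH (e ▸ hFA hx)
  apply Set.Subset.antisymm
  · rintro _ ⟨x, hx, rfl⟩
    rcases le_total (2 * t) (depth H c σ x) with hd | hd
    · rw [h.push_eq_self hd]
      exact ⟨hx, h.notMem_closedCap_of_lt_depth (by linarith [h.pos])⟩
    · have hxr := h.norm_sub_lt_of_depth_lt hd
      have h0 := h.depth_pos (hneH x hx)
      have hxP := facePoints_subset P (hFA hx)
      have hdx := h.depth_eq hxP hxr
      have hxN := (h.mem_iff hxr).1 hxP
      rw [h.push_eq_of_le (hneH x hx) hd]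
      set k := 1 / 2 + t / depth H c σ x with hk
      have hk0 : 0 < k := by have := div_pos h.pos h0; positivity
      have hkd : k * depth H c σ x = depth H c σ x / 2 + t := by rw [hk]; field_simp
      have hkc : inner ℝ c (k • (x - H)) = -(depth H c σ x / 2 + t) := by
        rw [inner_smul_right, ← hkd, hdx]; ring
      have hkr : ‖k • (x - H)‖ < r := by
        have h1 := h.le_depth _ ((smul_mem_polarCone_iff hk0).2 hxN)
        rw [hkc] at h1
        have h2 : σ * ‖k • (x - H)‖ < σ * r := by linarith [h.lt]
        exact lt_of_mul_lt_mul_left h2 h.sigma_pos.le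
      refine ⟨hrad x hx hxr k hk0 hkr, fun hcap => ?_⟩
      have := hcap.2
      rw [add_sub_cancel_left, hkc] at this
      linarith
  · rintro y ⟨hy, hycap⟩
    rcases le_total (2 * t) (depth H c σ y) with hd | hd
    · exact ⟨y, hy, h.push_eq_self hd⟩
    · have hyr := h.norm_sub_lt_of_depth_lt hd
      have h0 := h.depth_pos (hneH y hy)
      have hyP := facePoints_subset P (hFA hy)
      have hdy := h.depth_eq hyP hyr
      have hyN := (h.mem_iff hyr).1 hyP
      have hty : t < depth H c σ y := by
        by_contra! hle
        exact hycap ⟨hyN, by linarith⟩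
      -- the preimage lies on the same ray, at depth `2 * (depth y - t)`
      set k := 2 * (depth H c σ y - t) / depth H c σ y with hk
      have hk0 : 0 < k := div_pos (by linarith) h0
      have hk1 : k ≤ 1 := by rw [hk, div_le_one h0]; linarith
      have hkr : ‖k • (y - H)‖ < r := by
        rw [norm_smul, Real.norm_of_nonneg hk0.le]
        exact (mul_le_of_le_one_left (norm_nonneg _) hk1).trans_lt hyr
      have hmem := hrad y hy hyr k hk0 hkr
      have hdepth : depth H c σ (H + k • (y - H)) = 2 * (depth H c σ y - t) := by
        rw [h.depth_eq (facePoints_subset P (hFA hmem)) (by simpa using hkr), add_sub_cancel_left,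
          inner_smul_right, ← mul_neg, ← hdy, hk]
        field_simp
      refine ⟨_, hmem, ?_⟩
      rw [h.push_eq_of_le (hneH _ hmem) (by rw [hdepth]; linarith), hdepth, add_sub_cancel_left,
        smul_smul]
      have : (1 / 2 + t / (2 * (depth H c σ y - t))) * k = 1 := by
        have : depth H c σ y - t ≠ 0 := by linarith
        rw [hk]
        field_simp
        ring
      rw [this, one_smul, add_sub_cancel]

theorem isPreconnected_face_diff (h : CornerCut P H r N c σ t) (hH : H ∉ facePoints P) (x₀ : E3) :
    IsPreconnected (connectedComponentIn (facePoints P) x₀ \ closedCap H N c t) := by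
  rw [← h.image_push hH]
  refine isPreconnected_connectedComponentIn.image _ (h.continuousOn_push.mono ?_)
  exact fun x hx e => hH (e ▸ connectedComponentIn_subset _ _ hx)

theorem convex_capFace (H : E3) (N : Set E3) (c : E3) (t : ℝ) : Convex ℝ (capFace H N c t) := by
  intro x hx y hy a b ha hb hab
  have e : a • x + b • y - H = a • (x - H) + b • (y - H) := by
    have : a • (x - H) + b • (y - H) = a • x + b • y - (a + b) • H := by module
    rw [this, hab, one_smul]
  refine ⟨fun n hn => ?_, ?_⟩
  · rw [e, inner_add_right, inner_smul_right, inner_smul_right]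
    have h1 := hx.1 n hn
    have h2 := hy.1 n hn
    rcases ha.eq_or_lt with rfl | ha
    · rw [zero_add] at hab
      subst hab
      linarith
    · nlinarith
  · rw [e, inner_add_right, inner_smul_right, inner_smul_right, hx.2, hy.2]
    linear_combination (-t) * hab

theorem capFace_subset_closedCap : capFace H N c t ⊆ closedCap H N c t :=
  fun _ hx => ⟨fun n hn => (hx.1 n hn).le, hx.2.ge⟩

theorem capFace_subset_interior (h : CornerCut P H r N c σ t) :
    capFace H N c t ⊆ interior P := by
  intro x hx
  have hxr := h.norm_lt (capFace_subset_closedCap hx)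
  have hopen := ((isOpen_setOf_inner_neg h.corner.finite).preimage
    (by fun_prop : Continuous fun x : E3 => x - H)).mem_nhds hx.1
  rw [mem_interior_iff_mem_nhds]
  filter_upwards [hopen, eventually_norm_lt hxr] with y hy1 hy2
  exact (h.mem_iff hy2).2 fun n hn => (hy1 n hn).le

/-- The new face is separated from the remainders of the old faces: it lies in the interior of
`P`. -/
theorem subset_or_subset_of_isPreconnected (h : CornerCut P H r N c σ t) {s : Set E3}
    (hs : IsPreconnected s) (hsub : s ⊆ facePoints (P \ openCap H N c t)) :
    s ⊆ facePoints P \ closedCap H N c t ∨ s ⊆ capFace H N c t := by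
  rw [h.facePoints_diff] at hsub
  have hcover : s ⊆ (closedCap H N c t)ᶜ ∪ interior P := fun x hx =>
    (hsub hx).imp (fun h' => h'.2) fun h' => h.capFace_subset_interior h'
  have hdisj : s ∩ ((closedCap H N c t)ᶜ ∩ interior P) = ∅ := by
    rw [Set.eq_empty_iff_forall_notMem]
    rintro x ⟨hx, hx1, hx2⟩
    rcases hsub hx with h' | h'
    · exact (facePoints_subset_frontier P h'.1).2 hx2
    · exact hx1 (capFace_subset_closedCap h')
  refine (isPreconnected_iff_subset_of_disjoint.1 hs _ _ (isClosed_closedCap H N c t).isOpen_compl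
    isOpen_interior hcover hdisj).imp (fun h' x hx => ?_) fun h' x hx => ?_
  · exact (hsub hx).resolve_right fun h'' => h' hx (capFace_subset_closedCap h'')
  · exact (hsub hx).resolve_left fun h'' => (facePoints_subset_frontier P h''.1).2 (h' hx)

/-- The faces after the cut are the base of the cap and the remainders of the old faces. -/
theorem faces_diff (h : CornerCut P H r N c σ t) (hH : H ∉ facePoints P) :
    faces (P \ openCap H N c t) =
      insert (capFace H N c t) ((fun F => F \ closedCap H N c t) '' faces P) := by
  have hold : ∀ x ∈ facePoints P \ closedCap H N c t,
      connectedComponentIn (facePoints (P \ openCap H N c t)) x =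
        connectedComponentIn (facePoints P) x \ closedCap H N c t := by
    intro x hx
    have hx' : x ∈ facePoints (P \ openCap H N c t) := by rw [h.facePoints_diff]; exact Or.inl hx
    apply Set.Subset.antisymm
    · have hsub := (h.subset_or_subset_of_isPreconnected isPreconnected_connectedComponentIn
        (connectedComponentIn_subset _ x)).resolve_right fun h' =>
          hx.2 (capFace_subset_closedCap (h' (mem_connectedComponentIn hx')))
      refine Set.subset_sdiff.2 ⟨?_, Set.disjoint_left.2 fun y hy => (hsub hy).2⟩
      exact isPreconnected_connectedComponentIn.subset_connectedComponentIn
        (mem_connectedComponentIn hx') fun y hy => (hsub hy).1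
    · refine (h.isPreconnected_face_diff hH x).subset_connectedComponentIn
        ⟨mem_connectedComponentIn hx.1, hx.2⟩ ?_
      rw [h.facePoints_diff]
      exact fun y hy => Or.inl ⟨connectedComponentIn_subset _ _ hy.1, hy.2⟩
  have hnew : ∀ x ∈ capFace H N c t,
      connectedComponentIn (facePoints (P \ openCap H N c t)) x = capFace H N c t := by
    intro x hx
    have hx' := h.capFace_subset_facePoints hx
    apply Set.Subset.antisymm
    · exact (h.subset_or_subset_of_isPreconnected isPreconnected_connectedComponentIn
        (connectedComponentIn_subset _ x)).resolve_left fun h' =>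
          (h' (mem_connectedComponentIn hx')).2 (capFace_subset_closedCap hx)
    · exact (convex_capFace H N c t).isPreconnected.subset_connectedComponentIn hx
        h.capFace_subset_facePoints
  ext G
  simp only [Set.mem_insert_iff, Set.mem_image]
  constructor
  · rintro ⟨x, hx, rfl⟩
    have hx' := hx
    rw [h.facePoints_diff] at hx'
    rcases hx' with hx' | hx'
    · exact Or.inr ⟨_, ⟨x, hx'.1, rfl⟩, (hold x hx').symm⟩
    · exact Or.inl (hnew x hx')
  · rintro (rfl | ⟨F, ⟨x, hx, rfl⟩, rfl⟩)
    · obtain ⟨w, hw, hwt⟩ := h.exists_inner_neg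
      have hmem : H + w ∈ capFace H N c t := by
        refine ⟨fun n hn => ?_, ?_⟩ <;> rw [add_sub_cancel_left]
        exacts [hw n hn, hwt]
      exact ⟨H + w, h.capFace_subset_facePoints hmem, (hnew _ hmem).symm⟩
    · have hy : push H c σ t x ∈ connectedComponentIn (facePoints P) x \ closedCap H N c t := by
        rw [← h.image_push hH]
        exact ⟨x, mem_connectedComponentIn hx, rfl⟩
      have hyA : push H c σ t x ∈ facePoints P \ closedCap H N c t :=
        ⟨connectedComponentIn_subset _ _ hy.1, hy.2⟩
      refine ⟨push H c σ t x, ?_, ?_⟩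
      · rw [h.facePoints_diff]; exact Or.inl hyA
      · rw [hold _ hyA, connectedComponentIn_eq hy.1]

theorem numFaces_diff (h : CornerCut P H r N c σ t) (hH : H ∉ facePoints P) :
    numFaces (P \ openCap H N c t) = numFaces P + 1 := by
  have hne : ∀ F ∈ faces P, ∃ y ∈ F, y ∉ closedCap H N c t := by
    rintro _ ⟨x, hx, rfl⟩
    have : push H c σ t x ∈ connectedComponentIn (facePoints P) x \ closedCap H N c t := by
      rw [← h.image_push hH]
      exact ⟨x, mem_connectedComponentIn hx, rfl⟩
    exact ⟨_, this.1, this.2⟩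
  have hinj : Set.InjOn (fun F => F \ closedCap H N c t) (faces P) := by
    intro F hF G hG hFG
    obtain ⟨y, hyF, hyc⟩ := hne F hF
    have hyG : y ∈ G := by
      have : y ∈ F \ closedCap H N c t := ⟨hyF, hyc⟩
      have hFG : F \ closedCap H N c t = G \ closedCap H N c t := hFG
      rw [hFG] at this
      exact this.1
    obtain ⟨x, -, rfl⟩ := hF
    obtain ⟨x', -, rfl⟩ := hG
    rw [connectedComponentIn_eq hyF, connectedComponentIn_eq hyG]
  rw [numFaces, numFaces, h.faces_diff hH, Set.encard_insert_of_notMem, hinj.encard_image]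
  rintro ⟨F, hF, hFe⟩
  obtain ⟨y, hyF, hyc⟩ := hne F hF
  have hy : y ∈ F \ closedCap H N c t := ⟨hyF, hyc⟩
  have hFe : F \ closedCap H N c t = capFace H N c t := hFe
  rw [hFe] at hy
  exact hyc (capFace_subset_closedCap hy)

end CornerCut

/-! ### Change of edge length and of volume -/

open MeasureTheory

theorem hausdorffMeasure_sphere_complex_le {R : ℝ} (hR : 0 ≤ R) :
    μH[1] (Metric.sphere (0 : ℂ) R) ≤ ENNReal.ofReal (2 * Real.pi * R) := by
  have h1 := image_circleMap_Ioc 0 R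
  rw [abs_of_nonneg hR] at h1
  rw [← h1]
  refine ((lipschitzWith_circleMap 0 R).hausdorffMeasure_image_le zero_le_one _).trans ?_
  rw [hausdorffMeasure_real, Real.volume_Ioc, sub_zero, ENNReal.rpow_one, mul_comm,
    ENNReal.ofReal_mul Real.two_pi_pos.le]
  gcongr
  rw [ENNReal.ofReal, Real.toNNReal_of_nonneg hR]
  simp [Real.nnabs_of_nonneg hR, Real.toNNReal_of_nonneg hR]

/-- A map that does not decrease distances does not decrease lengths. -/
theorem hausdorffMeasure_le_of_dist_le {s : Set E3} {f : E3 → ℂ} {S : Set ℂ}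
    (hf : ∀ x ∈ s, ∀ y ∈ s, dist x y ≤ dist (f x) (f y)) (hS : Set.MapsTo f s S) :
    μH[1] s ≤ μH[1] S := by
  have h1 : AntilipschitzWith 1 (fun x : s => f x) :=
    AntilipschitzWith.of_le_mul_dist fun x y => by
      simpa [Subtype.dist_eq] using hf x x.2 y y.2
  have h2 : μH[1] s = μH[1] (Set.univ : Set s) := by
    rw [← (isometry_subtype_coe (s := s)).hausdorffMeasure_image (Or.inl zero_le_one)]
    simp
  rw [h2]
  refine (h1.le_hausdorffMeasure_image zero_le_one _).trans ?_
  rw [ENNReal.coe_one, ENNReal.one_rpow, one_mul]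
  refine measure_mono ?_
  rintro _ ⟨x, -, rfl⟩
  exact hS x.2

/-- The planes through the origin are isometric to `ℂ`. -/
theorem exists_isometry_orthogonal {c : E3} (hc : c ≠ 0) :
    Nonempty ((ℝ ∙ c)ᗮ ≃ₗᵢ[ℝ] ℂ) := by
  have : Fact (Module.finrank ℝ E3 = 2 + 1) := ⟨by simp⟩
  exact ⟨(Complex.isometryOfOrthonormal
    (OrthonormalBasis.fromOrthogonalSpanSingleton (𝕜 := ℝ) 2 hc)).symm⟩

/-- A ray from a point of a ball meets the bounding sphere. -/
theorem exists_norm_add_smul_eq {p m : E3} {R : ℝ} (hp : ‖p‖ ≤ R) (hm : m ≠ 0) :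
    ∃ s : ℝ, 0 ≤ s ∧ ‖p + s • m‖ = R := by
  have hmn : 0 < ‖m‖ := norm_pos_iff.2 hm
  have hR : 0 ≤ R := (norm_nonneg p).trans hp
  have hs : 0 ≤ 2 * R / ‖m‖ := by positivity
  have hcont : ContinuousOn (fun s : ℝ => ‖p + s • m‖) (Set.Icc 0 (2 * R / ‖m‖)) := by fun_prop
  have hmem : R ∈ Set.Icc ‖p + (0 : ℝ) • m‖ ‖p + (2 * R / ‖m‖) • m‖ := by
    refine ⟨by simpa using hp, ?_⟩
    have h1 : ‖(2 * R / ‖m‖) • m‖ = 2 * R := by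
      rw [norm_smul, Real.norm_of_nonneg hs, div_mul_cancel₀ _ hmn.ne']
    have h2 := norm_sub_le (p + (2 * R / ‖m‖) • m) p
    rw [add_sub_cancel_left, h1] at h2
    linarith
  obtain ⟨s, hs1, hs2⟩ := intermediate_value_Icc hs hcont hmem
  exact ⟨s, hs1.1, hs2⟩

namespace CornerCut

variable {P : Set E3} {H : E3} {r : ℝ} {N : Set E3} {c : E3} {σ t : ℝ}

/-- The boundary of the base of the cap, a convex region inside a disc, is at most as long as the
circle around the disc: moving each boundary point in the direction of a normal to the circle does
not decrease distances. -/
theorem hausdorffMeasure_capRing_le (h : CornerCut P H r N c σ t) {ρ : ℝ}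
    (hρ : ∀ v ∈ polarCone N, ‖orthComp c v‖ ≤ ρ * -inner ℝ c v) (hρ0 : 0 ≤ ρ) :
    μH[1] (capRing H N c t) ≤ ENNReal.ofReal (2 * Real.pi * (ρ * t)) := by
  have hc0 : c ≠ 0 := norm_ne_zero_iff.1 (by rw [h.norm_c]; norm_num)
  have hex : ∀ x ∈ capRing H N c t, ∃ q : (ℝ ∙ c)ᗮ, ‖q‖ = ρ * t ∧ ∃ n ∈ N,
      inner ℝ n (x - H) = (0 : ℝ) ∧ ∃ s : ℝ, 0 ≤ s ∧
        (q : E3) = orthComp c (x - H) + s • orthComp c n := by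
    rintro x ⟨hxN, hxt, n, hn, hn0⟩
    have h1 := hρ _ hxN
    rw [hxt, neg_neg] at h1
    have h2 : orthComp c n ≠ 0 := by
      intro h0
      rw [orthComp, sub_eq_zero] at h0
      have h3 := hn0
      rw [h0, inner_smul_left, hxt] at h3
      have h4 : inner ℝ c n = (0 : ℝ) := by
        have := h.pos.ne'
        simpa [this] using h3
      rw [h4, zero_smul] at h0
      have := h.corner.norm_eq_one n hn
      rw [h0, norm_zero] at this
      norm_num at this
    obtain ⟨s, hs, hsR⟩ := exists_norm_add_smul_eq h1 h2
    refine ⟨⟨orthComp c (x - H) + s • orthComp c n, ?_⟩, hsR, n, hn, hn0, s, hs, rfl⟩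
    rw [Submodule.mem_orthogonal_singleton_iff_inner_right, inner_add_right, inner_smul_right,
      inner_orthComp h.norm_c, inner_orthComp h.norm_c]
    simp
  choose! q hq using hex
  obtain ⟨L⟩ := exists_isometry_orthogonal hc0
  refine le_trans ?_ (hausdorffMeasure_sphere_complex_le (mul_nonneg hρ0 h.pos.le))
  refine hausdorffMeasure_le_of_dist_le (f := fun x => L (q x)) ?_ ?_
  · intro x hx y hy
    rw [L.dist_map]
    obtain ⟨-, n, hn, hnx, s, hs, hqx⟩ := hq x hx
    obtain ⟨-, m, hm, hmy, s', hs', hqy⟩ := hq y hy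
    rw [Subtype.dist_eq, hqx, hqy, dist_eq_norm, dist_eq_norm]
    have hcxy : inner ℝ c (x - y) = (0 : ℝ) := by
      have := hx.2.1
      have := hy.2.1
      rw [show x - y = (x - H) - (y - H) by abel, inner_sub_right]
      linarith
    have e : orthComp c (x - H) + s • orthComp c n - (orthComp c (y - H) + s' • orthComp c m) =
        (x - y) + (s • orthComp c n - s' • orthComp c m) := by
      have : orthComp c (x - H) - orthComp c (y - H) = x - y := by
        simp only [orthComp]
        rw [hx.2.1, hy.2.1]
        abel
      rw [← this]
      abel
    have horth : ∀ k : E3, inner ℝ (x - y) (orthComp c k) = (inner ℝ k (x - y) : ℝ) := by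
      intro k
      rw [orthComp, inner_sub_right, inner_smul_right, real_inner_comm c (x - y), hcxy,
        real_inner_comm]
      ring
    have h1 : 0 ≤ inner ℝ n (x - y) := by
      have := hy.1 n hn
      rw [show x - y = (x - H) - (y - H) by abel, inner_sub_right, hnx]
      linarith
    have h2 : inner ℝ m (x - y) ≤ 0 := by
      have := hx.1 m hm
      rw [show x - y = (x - H) - (y - H) by abel, inner_sub_right, hmy]
      linarith
    rw [e]
    refine le_of_sq_le_sq ?_ (norm_nonneg _)
    rw [norm_add_sq_real, inner_sub_right, inner_smul_right, inner_smul_right, horth, horth]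
    nlinarith [sq_nonneg ‖s • orthComp c n - s' • orthComp c m‖, mul_nonneg hs h1,
      mul_nonpos_of_nonneg_of_nonpos hs' h2]
  · intro x hx
    rw [mem_sphere_zero_iff_norm, L.norm_map]
    exact (hq x hx).1

/-- Each edge ending at `H` runs through the whole depth of the cap. -/
theorem exists_subset_edge (h : CornerCut P H r N c σ t) (hP : IsClosed P)
    (hH : H ∈ vertices P) {e : Set E3} (he : e ∈ edges P) (hHe : H ∈ closure e) :
    ∃ s : Set E3, MeasurableSet s ∧ s ⊆ e ∩ closedCap H N c t ∧
      ENNReal.ofReal t ≤ μH[1] s := by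
  obtain ⟨x₀, hx₀, rfl⟩ := he
  obtain ⟨x, hxr, hx⟩ := mem_closure_iff.1 hHe _ Metric.isOpen_ball
    (Metric.mem_ball_self h.corner.pos)
  have hxr : ‖x - H‖ < r := by simpa [dist_eq_norm] using hxr
  have hxE := connectedComponentIn_subset _ _ hx
  have hxP := hP.frontier_subset hxE.1.1
  have hxN := (h.mem_iff hxr).1 hxP
  have hne : x ≠ H := fun e => hH.2 (e ▸ hxE)
  have hd : 0 < -inner ℝ c (x - H) := (mul_pos h.sigma_pos
    (norm_pos_iff.2 (sub_ne_zero.2 hne))).trans_le (h.le_depth _ hxN)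
  set k := t / -inner ℝ c (x - H) with hk
  have hk0 : 0 < k := div_pos h.pos hd
  have hkc : ∀ j : ℝ, inner ℝ c ((j * k) • (x - H)) = -(j * t) := by
    intro j
    have : k * -inner ℝ c (x - H) = t := div_mul_cancel₀ _ hd.ne'
    rw [inner_smul_right, ← this]
    ring
  have hmem : ∀ j : ℝ, 0 < j → j ≤ 1 → H + (j * k) • (x - H) ∈
      connectedComponentIn (edgePoints P) x₀ ∩ closedCap H N c t := by
    intro j hj hj1
    have hjk := mul_pos hj hk0
    have h1 : (j * k) • (x - H) ∈ polarCone N := (smul_mem_polarCone_iff hjk).2 hxN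
    have h2 : -t ≤ inner ℝ c ((j * k) • (x - H)) := by
      rw [hkc]
      nlinarith [h.pos]
    have h3 : ‖(j * k) • (x - H)‖ < r := by linarith [h.norm_lt_of_mem h1 h2, h.corner.pos]
    refine ⟨?_, by simpa using h1, by simpa using h2⟩
    have := smul_mem_connectedComponentIn (B := edgePoints P) (H := H) (v := x - H) (r := r)
      (k := j * k) (fun i hi hir => ?_) hxr hjk h3
    · rwa [add_sub_cancel, ← connectedComponentIn_eq hx] at this
    · have := h.corner.isConeNear.sameGerm hi hxr hir
      rw [add_sub_cancel] at this
      exact this.mem_edgePoints hxE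
  refine ⟨segment ℝ H (H + k • (x - H)) \ {H}, ?_, ?_, ?_⟩
  · refine MeasurableSet.diff ?_ (measurableSet_singleton H)
    rw [segment_eq_image_lineMap]
    exact (isCompact_Icc.image AffineMap.lineMap_continuous).isClosed.measurableSet
  · rintro y ⟨hy, hyH⟩
    rw [segment_eq_image'] at hy
    obtain ⟨j, ⟨hj0, hj1⟩, rfl⟩ := hy
    simp only [add_sub_cancel_left, smul_smul] at hyH ⊢
    refine hmem j (lt_of_le_of_ne hj0 ?_) hj1
    rintro rfl
    exact hyH (by simp)
  · have := Measure.nullSingletonClass_hausdorff E3 one_pos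
    rw [measure_sdiff_null (measure_singleton H), hausdorffMeasure_segment, edist_dist,
      dist_self_add_right]
    refine ENNReal.ofReal_le_ofReal ?_
    have h1 := hkc 1
    have h2 := abs_real_inner_le_norm c (k • (x - H))
    rw [one_mul, one_mul] at h1
    rw [h1, h.norm_c, abs_neg, abs_of_pos h.pos, one_mul] at h2
    exact h2

/-- The edges ending at `H` lose in total at least `t` times their number. -/
theorem degree_mul_le (h : CornerCut P H r N c σ t) (hP : IsClosed P) (hH : H ∈ vertices P) :
    ENNReal.ofReal (degree P H * t) ≤ μH[1] (skeleton P ∩ closedCap H N c t) := by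
  set E : Set (Set E3) := {e | e ∈ edges P ∧ H ∈ closure e} with hE
  have hdeg : degree P H = E.ncard := rfl
  rcases E.finite_or_infinite with hfin | hinf
  · have hex : ∀ e ∈ E, ∃ s : Set E3, MeasurableSet s ∧ s ⊆ e ∩ closedCap H N c t ∧
        ENNReal.ofReal t ≤ μH[1] s := fun e he => h.exists_subset_edge hP hH he.1 he.2
    choose! s hs1 hs2 hs3 using hex
    have hdisj : E.PairwiseDisjoint s := by
      intro e he e' he' hne
      refine Set.disjoint_left.2 fun y hy hy' => hne ?_
      obtain ⟨⟨x, -, rfl⟩, -⟩ := id he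
      obtain ⟨⟨x', -, rfl⟩, -⟩ := id he'
      rw [connectedComponentIn_eq (hs2 _ he hy).1, connectedComponentIn_eq (hs2 _ he' hy').1]
    have hsub : (⋃ e ∈ hfin.toFinset, s e) ⊆ skeleton P ∩ closedCap H N c t := by
      refine Set.iUnion₂_subset fun e he y hy => ?_
      have he : e ∈ E := hfin.mem_toFinset.1 he
      have hy' := hs2 e he hy
      obtain ⟨x, -, rfl⟩ := he.1
      exact ⟨(connectedComponentIn_subset _ _ hy'.1).1, hy'.2⟩
    refine le_trans ?_ (measure_mono hsub)
    rw [measure_biUnion_finset (by simpa using hdisj)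
      fun e he => hs1 e (hfin.mem_toFinset.1 he)]
    refine le_trans ?_ (Finset.card_nsmul_le_sum _ _ (ENNReal.ofReal t)
      fun e he => hs3 e (hfin.mem_toFinset.1 he))
    rw [hdeg, Set.ncard_eq_toFinset_card E hfin, ENNReal.ofReal_mul (Nat.cast_nonneg _),
      ENNReal.ofReal_natCast, nsmul_eq_mul]
  · -- `Set.ncard` is zero on infinite sets
    rw [hdeg, hinf.ncard]
    simp

/-- Cutting removes at least the length `t` from each edge at `H`, and adds at most the length of
the circle around the base of the cap. -/
theorem edgeLength_diff_le (h : CornerCut P H r N c σ t) (hP : IsPolyhedron P)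
    (hH : H ∈ vertices P) {ρ : ℝ}
    (hρ : ∀ v ∈ polarCone N, ‖orthComp c v‖ ≤ ρ * -inner ℝ c v) (hρ0 : 0 ≤ ρ) :
    edgeLength (P \ openCap H N c t) ≤
      edgeLength P - (degree P H - 2 * Real.pi * ρ) * t := by
  have hPc : IsClosed P := by rw [← hP.regular]; exact isClosed_closure
  have hfin := hP.hausdorffMeasure_skeleton_lt_top
  have h1 : μH[1] (skeleton (P \ openCap H N c t)) ≤
      μH[1] (skeleton P \ closedCap H N c t) + ENNReal.ofReal (2 * Real.pi * (ρ * t)) :=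
    (measure_mono (h.skeleton_diff_subset hP)).trans ((measure_union_le _ _).trans
      (by gcongr; exact h.hausdorffMeasure_capRing_le hρ hρ0))
  have h2 := measure_inter_add_sdiff (μ := (μH[1] : Measure E3)) (skeleton P)
    (isClosed_closedCap H N c t).measurableSet
  have h3 := h.degree_mul_le hPc hH
  have hf1 : μH[1] (skeleton P \ closedCap H N c t) ≠ ⊤ :=
    (measure_mono Set.sdiff_subset).trans_lt hfin |>.ne
  have hf2 : μH[1] (skeleton P ∩ closedCap H N c t) ≠ ⊤ :=
    (measure_mono Set.inter_subset_left).trans_lt hfin |>.ne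
  have r1 := ENNReal.toReal_mono (ENNReal.add_ne_top.2 ⟨hf1, ENNReal.ofReal_ne_top⟩) h1
  rw [ENNReal.toReal_add hf1 ENNReal.ofReal_ne_top, ENNReal.toReal_ofReal
    (mul_nonneg Real.two_pi_pos.le (mul_nonneg hρ0 h.pos.le))] at r1
  have r2 := congrArg ENNReal.toReal h2
  rw [ENNReal.toReal_add hf2 hf1] at r2
  have r3 := (ENNReal.ofReal_le_iff_le_toReal hf2).1 h3
  rw [edgeLength, edgeLength]
  linarith

theorem le_vol_diff (h : CornerCut P H r N c σ t) (hP : IsPolyhedron P) :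
    vol P - vol (Metric.closedBall 0 1) / σ ^ 3 * t ^ 3 ≤ vol (P \ openCap H N c t) := by
  have hts : 0 ≤ t / σ := (div_pos h.pos h.sigma_pos).le
  have hsub : P ⊆ (P \ openCap H N c t) ∪ Metric.closedBall H (t / σ) := by
    intro x hx
    by_cases hxc : x ∈ openCap H N c t
    · right
      rw [Metric.mem_closedBall, dist_eq_norm, le_div_iff₀ h.sigma_pos]
      have h1 := h.le_depth _ hxc.1
      have h2 := hxc.2
      linarith
    · exact Or.inl ⟨hx, hxc⟩
  have h1 := (measure_mono (μ := volume) hsub).trans (measure_union_le _ _)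
  rw [Measure.addHaar_closedBall' _ _ hts] at h1
  have hf1 : volume (P \ openCap H N c t) ≠ ⊤ :=
    (hP.bounded.subset Set.sdiff_subset).measure_lt_top.ne
  have hf2 : volume (Metric.closedBall (0 : E3) 1) ≠ ⊤ := measure_closedBall_lt_top.ne
  have hf3 := ENNReal.mul_ne_top (ENNReal.ofReal_ne_top (r := (t / σ) ^ Module.finrank ℝ E3)) hf2
  have r1 := ENNReal.toReal_mono (ENNReal.add_ne_top.2 ⟨hf1, hf3⟩) h1
  rw [ENNReal.toReal_add hf1 hf3, ENNReal.toReal_mul, ENNReal.toReal_ofReal (by positivity),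
    finrank_euclideanSpace_fin, div_pow] at r1
  rw [vol, vol, vol]
  have : (volume (Metric.closedBall (0 : E3) 1)).toReal / σ ^ 3 * t ^ 3 =
    t ^ 3 / σ ^ 3 * (volume (Metric.closedBall (0 : E3) 1)).toReal := by ring
  linarith

end CornerCut

/-! ### Shaving the corner -/

theorem IsPolyhedron.vol_pos {P : Set E3} (hP : IsPolyhedron P) : 0 < vol P := by
  have hne : (interior P).Nonempty := by
    rw [← closure_nonempty_iff, hP.regular]
    exact hP.nonempty
  exact ENNReal.toReal_pos (Measure.measure_pos_of_nonempty_interior _ hne).ne'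
    hP.bounded.measure_lt_top.ne

/-- A loss of length of order `t` outweighs a loss of volume of order `t ^ 3` in the ratio of the
cube of the length to the volume. -/
theorem div_lt_div_of_length_volume {e e' v v' δ κ t : ℝ} (he' : 0 ≤ e') (hδ : 0 < δ) (ht : 0 < t)
    (hκ : 0 ≤ κ) (hv : 0 < v) (hle : e' ≤ e - δ * t) (hvv : v - κ * t ^ 3 ≤ v')
    (hsmall : e * κ * t ^ 2 < δ * v) : e' ^ 3 / v' < e ^ 3 / v := by
  have hδt := mul_pos hδ ht
  have he : 0 < e := by linarith
  have h1 : 0 < v - κ * t ^ 3 := by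
    have h2 : δ * (κ * t ^ 3) ≤ e * κ * t ^ 2 := by
      have : δ * t * (κ * t ^ 2) ≤ e * (κ * t ^ 2) :=
        mul_le_mul_of_nonneg_right (by linarith) (by positivity)
      nlinarith
    have : δ * (κ * t ^ 3) < δ * v := h2.trans_lt hsmall
    linarith [lt_of_mul_lt_mul_left this hδ.le]
  have hv' : 0 < v' := h1.trans_le hvv
  rw [div_lt_div_iff₀ hv' hv]
  have h3 : e' ^ 3 ≤ e ^ 2 * (e - δ * t) := by
    calc e' ^ 3 = e' ^ 2 * e' := by ring
      _ ≤ e ^ 2 * (e - δ * t) := by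
        have : e' ^ 2 ≤ e ^ 2 := pow_le_pow_left₀ he' (by linarith) 2
        exact mul_le_mul this hle he' (by positivity)
  calc e' ^ 3 * v ≤ e ^ 2 * (e - δ * t) * v := mul_le_mul_of_nonneg_right h3 hv.le
    _ = e ^ 3 * v - e ^ 2 * t * (δ * v) := by ring
    _ < e ^ 3 * v - e ^ 2 * t * (e * κ * t ^ 2) := by
      have := mul_lt_mul_of_pos_left hsmall (by positivity : 0 < e ^ 2 * t)
      linarith
    _ = e ^ 3 * (v - κ * t ^ 3) := by ring
    _ ≤ e ^ 3 * v' := mul_le_mul_of_nonneg_left hvv (by positivity)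

/-- The corner shaved off inside a convex neighbourhood is, for small `t`, the cap of the cone. -/
theorem IsCorner.eventually_shave_eq {P : Set E3} {H : E3} {r : ℝ} {N : Set E3} {c : E3} {σ : ℝ}
    (h : IsCorner P H r N) (hσ : 0 < σ) (hc : ∀ v ∈ polarCone N, σ * ‖v‖ ≤ -inner ℝ c v)
    {U : Set E3} (hU : IsOpen U) (hHU : H ∈ U) (hconv : Convex ℝ (U ∩ P)) :
    ∀ᶠ t in 𝓝[>] (0 : ℝ), shave P U H c t = P \ openCap H N c t := by
  obtain ⟨ρ, hρ, hball⟩ := Metric.isOpen_iff.1 hU H hHU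
  have hHP : H ∈ P := by
    have := (h.mem_iff 0 (by simpa using h.pos)).2 fun n _ => by simp
    simpa using this
  have hcone : ∀ x ∈ U ∩ P, x - H ∈ polarCone N := by
    intro x hx
    have hc : Continuous fun s : ℝ => ‖s • (x - H)‖ := by fun_prop
    have h1 : ∀ᶠ s in 𝓝[>] (0 : ℝ), ‖s • (x - H)‖ < r :=
      (hc.continuousAt.eventually_lt continuousAt_const (by simpa using h.pos)).filter_mono
        nhdsWithin_le_nhds
    obtain ⟨s, hs, hs0, hs1⟩ := (h1.and (Ioo_mem_nhdsGT one_pos)).exists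
    rw [← smul_mem_polarCone_iff hs0, ← h.mem_iff _ hs]
    have := hconv ⟨hHU, hHP⟩ hx (a := 1 - s) (b := s) (by linarith) hs0.le (by ring)
    convert this.2 using 1
    module
  filter_upwards [Ioo_mem_nhdsGT (mul_pos hσ hρ)] with t ht
  have hcap : openCap H N c t ⊆ U := by
    intro x hx
    refine hball ?_
    rw [Metric.mem_ball, dist_eq_norm]
    have h1 := hc _ hx.1
    have h2 := hx.2
    exact lt_of_mul_lt_mul_left (show σ * ‖x - H‖ < σ * ρ by linarith [ht.2]) hσ.le
  ext x
  constructor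
  · rintro (⟨hxP, hxU⟩ | ⟨⟨hxU, hxP⟩, hxt⟩)
    · exact ⟨hxP, fun hx => hxU (hcap hx)⟩
    · exact ⟨hxP, fun hx => absurd hx.2 (not_lt.2 hxt)⟩
  · rintro ⟨hxP, hx⟩
    by_cases hxU : x ∈ U
    · exact Or.inr ⟨⟨hxU, hxP⟩, not_lt.1 fun hlt => hx ⟨hcone x ⟨hxU, hxP⟩, hlt⟩⟩
    · exact Or.inl ⟨hxP, hxU⟩

end Melzak

theorem mainTheorem6 (P : Set Melzak.E3) (hP : Melzak.IsPolyhedron P)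
    (H : Melzak.E3) (hH : Melzak.IsExposedVertex P H)
    (hdeg : (Melzak.degree P H : ℝ) >
      2 * Real.pi / Real.tan (Melzak.inradius (Melzak.gaussImage P H))) :
    ∃ c : Melzak.E3, Melzak.IsIncenter (Melzak.gaussImage P H) c ∧
      ∀ U : Set Melzak.E3, IsOpen U → H ∈ U → Convex ℝ (U ∩ P) →
        ∀ᶠ t : ℝ in 𝓝[>] 0,
          Melzak.IsPolyhedron (Melzak.shave P U H c t) ∧
          Melzak.numFaces (Melzak.shave P U H c t) = Melzak.numFaces P + 1 ∧
          Melzak.melzakRatio (Melzak.shave P U H c t) < Melzak.melzakRatio P := by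
  open Melzak in
  obtain ⟨r, hr⟩ := hH.exists_isCorner hP
  have hHv := hH.1
  set N := gaussVertices P H with hN
  obtain ⟨w, hw⟩ := hr.exists_neg
  obtain ⟨ρ₀, hρ₀, c₀, hc₀, hd₀⟩ :=
    exists_sphericalDisc_subset fun d hd => hr.exists_inner_ne_zero hHv hd
  rw [← gaussImage_eq] at hd₀
  have hclosed : IsClosed (gaussImage P H) := by
    rw [gaussImage_eq]; exact isClosed_unit_coneOver hr.finite hw
  obtain ⟨c, hc, hθ0, hθ⟩ := exists_isIncenter hclosed (w := w) (by
    intro y hy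
    rw [gaussImage_eq] at hy
    exact inner_neg_of_mem_coneOver hw hy.2) hρ₀ hc₀ hd₀
  refine ⟨c, hc, fun U hU hHU hconv => ?_⟩
  set θ := inradius (gaussImage P H) with hθdef
  have hsin : 0 < Real.sin θ := Real.sin_pos_of_pos_of_lt_pi hθ0 (by linarith [Real.pi_pos])
  have hcos : 0 < Real.cos θ := Real.cos_pos_of_mem_Ioo ⟨by linarith, hθ⟩
  have hkey : ∀ v ∈ polarCone N, ‖orthComp c v‖ * Real.sin θ ≤ -inner ℝ c v * Real.cos θ := by
    intro v hv
    refine norm_orthComp_mul_sin_le hc.1 hθ0.le hθ.le fun y hy => ?_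
    have := hc.2 hy
    rw [gaussImage_eq] at this
    exact inner_nonpos_of_mem_coneOver hv this.2
  have hdepth0 : ∀ v ∈ polarCone N, 0 ≤ -(inner ℝ c v : ℝ) := by
    intro v hv
    have h1 := hkey v hv
    have h2 : 0 ≤ ‖orthComp c v‖ * Real.sin θ := by positivity
    exact nonneg_of_mul_nonneg_left (h2.trans h1) hcos
  have hρ : ∀ v ∈ polarCone N, ‖orthComp c v‖ ≤ (Real.tan θ)⁻¹ * -inner ℝ c v := by
    intro v hv
    rw [Real.tan_eq_sin_div_cos, inv_div, div_mul_eq_mul_div, le_div_iff₀ hsin]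
    linarith [hkey v hv]
  have hσ : ∀ v ∈ polarCone N, Real.sin θ * ‖v‖ ≤ -inner ℝ c v := by
    intro v hv
    refine le_of_sq_le_sq ?_ (hdepth0 v hv)
    have h1 := pow_le_pow_left₀ (by positivity) (hkey v hv) 2
    rw [mul_pow, norm_sq_eq_add_orthComp hc.1 v]
    nlinarith [Real.sin_sq_add_cos_sq θ]
  have htan : 0 < Real.tan θ := Real.tan_pos_of_pos_of_lt_pi_div_two hθ0 hθ
  have hδ : 0 < (degree P H : ℝ) - 2 * Real.pi * (Real.tan θ)⁻¹ := by
    rw [← div_eq_mul_inv]; linarith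
  -- `δ * t` bounds the loss of length from below, `κ * t ^ 3` the loss of volume from above
  set δ := (degree P H : ℝ) - 2 * Real.pi * (Real.tan θ)⁻¹ with hδdef
  set κ := vol (Metric.closedBall 0 1) / Real.sin θ ^ 3 with hκdef
  have hκ : 0 ≤ κ := div_nonneg ENNReal.toReal_nonneg (by positivity)
  have hsmall : ∀ᶠ t in 𝓝[>] (0 : ℝ), edgeLength P * κ * t ^ 2 < δ * vol P := by
    have hcont : Continuous fun t : ℝ => edgeLength P * κ * t ^ 2 := by fun_prop
    refine (hcont.continuousAt.eventually_lt continuousAt_const ?_).filter_mono nhdsWithin_le_nhds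
    simpa using mul_pos hδ hP.vol_pos
  filter_upwards [hr.eventually_shave_eq hsin hσ hU hHU hconv, hsmall,
    Ioo_mem_nhdsGT (show 0 < Real.sin θ * r / 2 by have := hr.pos; positivity)] with t ht hts htr
  have hcut : CornerCut P H r N c (Real.sin θ) t :=
    ⟨hr, hc.1, hsin, hσ, htr.1, by linarith [htr.2]⟩
  rw [ht]
  refine ⟨hcut.isPolyhedron_diff hP, hcut.numFaces_diff hHv.1.2, ?_⟩
  exact div_lt_div_of_length_volume ENNReal.toReal_nonneg hδ htr.1 hκ hP.vol_pos
    (hcut.edgeLength_diff_le hP hHv hρ (inv_nonneg.2 htan.le)) (hcut.le_vol_diff hP) hts
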